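/- Conventions. For $S\subseteq\mathbb R^d$ let $\dim S$ be the dimension of its affine span and $h_S(v)=-\min_{y\in S}\langle v,y\rangle$ its support function. For a polytope $P$ the normal fan $\mathcal N(P)$ consists of the cones $C_F=\{v : h_P(v)=-\langle v,y\rangle \text{ for all } y\in F\}$, $F$ a non-empty face of $P$. For a fan $\mathcal F$, generators $\mathbf v$ of its rays (one for each ray), a triangulation $\mathcal T$ of $\mathcal F$ into full-dimensional simplicial cones generated by these vectors, and a function $h$ with values in a field containing $\mathbb R$, put $$f_{\mathcal F,\mathbf v,\mathcal T}(h)=\sum_{\mathrm{cone}(v_{1},\dots,v_{d})\in\mathcal T}\frac{|\det(v_{1},\dots,v_{d})|}{h(v_{1})\cdots h(v_{d})},$$ and let $f_{\mathcal F}(h)$ be the common value of these sums for all $\mathbf v$ and $\mathcal T$. For a sequence $\mathbf P=(P_1,\dots,P_r)$ of polytopes in $\mathbb R^d$ let $P=P_1+\dots+P_r$ be the Minkowski sum and $h_{\mathbf x\mathbf P}=\sum_i x_ih_{P_i}$. The sequence is regular if $\dim P=d$ and there is $\mathbf x\in\mathbb R^r$ with $h_{\mathbf x\mathbf P}(v)\ne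 0$ for every generator $v$ of a ray of $\mathcal N(P)$. The dual mixed volume of a regular sequence is the rational function $m_{\mathbf P}(\mathbf x)=f_{\mathcal N(P)}(h_{\mathbf x\mathbf P})$ in the variables $x_1,\dots,x_r$. If $\dim P=d$, then $m_{\mathbf P}(\mathbf x,\mathbf z)$ is the dual mixed volume of the (regular) sequence $(P_1,\dots,P_r,\{-e_1\},\dots,\{-e_d\})$ in the variables $x_1,\dots,x_r,z_1,\dots,z_d$. A full-dimensional polytope is non-codegenerate if $0$ is not in the affine span of any of its facets. A fine mixed cell is a sequence $\mathbf P=(P_1,\dots,P_r)$ of simplices in $\mathbb R^d$ such that, with $d_i=\dim P_i$, both $d_1+\dots+d_r=d$ and $\dim(P_1+\dots+P_r)=d$. Normalised normal rays of $\mathbf P$ are vectors $v_{i,a}\in\mathbb R^d$ ($1\le i\le r$, $1\le a\le d_i+1$) such that: if $d_i=0$, then $v_{i,1}=0$; if $d_i>0$, then there is an enumeration $F_{i,1},\dots,F_{i,d_i+1}$ of the facets of $P_i$ such that $v_{i,a}$ lies in the cone $C_{F_{i,a}}$ of $\mathcal N(P_i)$, $v_{i,a}$ is normal to the affine span of $P_k$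 for every $k\neq i$, and $\max_{y\in P_i}\langle y,v_{i,a}\rangle-\min_{y\in P_i}\langle y,v_{i,a}\rangle=1$. Put $\kappa(\mathbf P)=|\det(v_{i,j})_{1\le i\le r,\,1\le j\le d_i}|$. Proposition. Let $\mathbf P=(P_1,\dots,P_r)$ be a fine mixed cell in $\mathbb R^d$. Then normalised normal rays of $\mathbf P$ exist, and for every choice of normalised normal rays $v_{i,a}$ the following identity of rational functions holds: $$m_{\mathbf P}(\mathbf x,\mathbf z)=\kappa(\mathbf P)\,\frac{\prod_{i:d_i>0}x_i}{\prod_{i:d_i>0}\prod_{a=1}^{d_i+1}\bigl(h_{\mathbf x\mathbf P}(v_{i,a})+\langle v_{i,a},\mathbf z\rangle\bigr)},\qquad h_{\mathbf x\mathbf P}(v)=\sum_{i=1}^r x_ih_{P_i}(v).$$ If $\mathbf P$ is regular, in particular if $P_1+\dots+P_r$ is non-codegenerate, then also $$m_{\mathbf P}(\mathbf x)=\kappa(\mathbf P)\,\frac{\prod_{i:d_i>0}x_i}{\prod_{i:d_i>0}\prod_{a=1}^{d_i+1}h_{\mathbf x\mathbf P}(v_{i,a})}.$$ -/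

import Mathlib

open scoped Pointwise

namespace DualMixed

noncomputable section

/-! ### Convex geometry -/

/-- The dimension of a (non-empty) set: the dimension of its affine span. -/
def dim {d : ℕ} (S : Set (EuclideanSpace ℝ (Fin d))) : ℕ :=
  Module.finrank ℝ (vectorSpan ℝ S)

/-- The support function `h_S(v) = - min_{y ∈ S} ⟨v, y⟩`. -/
def supportFn {d : ℕ} (S : Set (EuclideanSpace ℝ (Fin d))) (v : EuclideanSpace ℝ (Fin d)) : ℝ :=
  - sInf ((fun y => inner ℝ v y) '' S)

/-- `F` is a non-empty face of `P`: the set of points of `P` at which some linear function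
attains its maximum over `P`. -/
def IsFace {d : ℕ} (P F : Set (EuclideanSpace ℝ (Fin d))) : Prop :=
  F.Nonempty ∧ F ⊆ P ∧ ∃ (y : EuclideanSpace ℝ (Fin d)) (b : ℝ),
    (∀ x ∈ F, inner ℝ x y = b) ∧ ∀ x ∈ P \ F, inner ℝ x y < b

/-- `F` is a facet of `P`: a face of codimension one in `P`. -/
def IsFacet {d : ℕ} (P F : Set (EuclideanSpace ℝ (Fin d))) : Prop :=
  IsFace P F ∧ dim F + 1 = dim P

/-- The cone `C_F` of the normal fan: the vectors `v` such that `h_P(v) = -⟨v, y⟩` (and is finite)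
for every `y ∈ F`, that is, such that every point of `F` minimises `⟨v, ·⟩` over `P`. -/
def normalCone {d : ℕ} (P F : Set (EuclideanSpace ℝ (Fin d))) : Set (EuclideanSpace ℝ (Fin d)) :=
  {v | ∀ y ∈ F, ∀ x ∈ P, inner ℝ v y ≤ inner ℝ v x}

/-- The normal fan of `P`, as a set of cones. -/
def normalFan {d : ℕ} (P : Set (EuclideanSpace ℝ (Fin d))) :
    Set (Set (EuclideanSpace ℝ (Fin d))) :=
  {C | ∃ F, IsFace P F ∧ C = normalCone P F}

/-- The ray `ℝ_{≥ 0} v`. -/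
def rayOf {d : ℕ} (v : EuclideanSpace ℝ (Fin d)) : Set (EuclideanSpace ℝ (Fin d)) :=
  {w | ∃ t : ℝ, 0 ≤ t ∧ w = t • v}

/-- `v` generates a ray (a one-dimensional pointed cone) of the fan `N`. -/
def GeneratesRay {d : ℕ} (N : Set (Set (EuclideanSpace ℝ (Fin d))))
    (v : EuclideanSpace ℝ (Fin d)) : Prop :=
  v ≠ 0 ∧ rayOf v ∈ N

/-- `P` is non-codegenerate: the origin is not in the affine span of any facet of `P`. -/
def NonCodegenerate {d : ℕ} (P : Set (EuclideanSpace ℝ (Fin d))) : Prop :=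
  ∀ F, IsFacet P F → (0 : EuclideanSpace ℝ (Fin d)) ∉ affineSpan ℝ F

/-! ### Triangulated fans and the rational function of a fan -/

/-- `V` consists of exactly one generator of every ray of the fan `N`. -/
def IsRayGenerators {d : ℕ} (N : Set (Set (EuclideanSpace ℝ (Fin d))))
    (V : Finset (EuclideanSpace ℝ (Fin d))) : Prop :=
  (∀ v ∈ V, GeneratesRay N v) ∧ ∀ w, GeneratesRay N w → ∃! v, v ∈ V ∧ rayOf v = rayOf w

/-- The closed convex cone spanned by a finite set of vectors. -/
def coneOf {d : ℕ} (σ : Finset (EuclideanSpace ℝ (Fin d))) : Set (EuclideanSpace ℝ (Fin d)) :=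
  (PointedCone.hull ℝ (σ : Set (EuclideanSpace ℝ (Fin d))) : Set (EuclideanSpace ℝ (Fin d)))

/-- `T` is a triangulation of the fan `N` into full-dimensional simplicial cones, each of them
given by its `d` generators, which are taken from the set `V` of generators of the rays of `N`. -/
structure IsTriangulation {d : ℕ} (N : Set (Set (EuclideanSpace ℝ (Fin d))))
    (V : Finset (EuclideanSpace ℝ (Fin d)))
    (T : Finset (Finset (EuclideanSpace ℝ (Fin d)))) : Prop where
  generators : IsRayGenerators N V
  subset : ∀ σ ∈ T, σ ⊆ V
  card_eq : ∀ σ ∈ T, σ.card = d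
  linearIndependent : ∀ σ ∈ T,
    LinearIndependent ℝ (fun v : {v // v ∈ σ} => (v : EuclideanSpace ℝ (Fin d)))
  refines : ∀ σ ∈ T, ∃ C ∈ N, coneOf σ ⊆ C
  covers : (⋃ σ ∈ T, coneOf σ) = ⋃₀ N
  inter_face : ∀ σ ∈ T, ∀ τ ∈ T, IsFace (coneOf σ) (coneOf σ ∩ coneOf τ)

/-- `|det (v₁, …, v_d)|` for a set `σ = {v₁, …, v_d}` of `d` vectors
(it does not depend on the order; junk value `0` if the number of vectors is not `d`). -/
def absDet {d : ℕ} (σ : Finset (EuclideanSpace ℝ (Fin d))) : ℝ :=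
  if h : σ.card = d then
    |(Matrix.of fun i j : Fin d => ((σ.equivFinOfCardEq h).symm i : EuclideanSpace ℝ (Fin d)) j).det|
  else 0

/-- `f_{N,V,T}(u) = ∑_{σ ∈ T} |det σ| / ∏_{v ∈ σ} u_v`, evaluated at `u_v = h(v)`. -/
def triangulationSum {d : ℕ} {K : Type*} [Field K] [Algebra ℝ K]
    (T : Finset (Finset (EuclideanSpace ℝ (Fin d)))) (h : EuclideanSpace ℝ (Fin d) → K) : K :=
  ∑ σ ∈ T, algebraMap ℝ K (absDet σ) / ∏ v ∈ σ, h v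

open Classical in
/-- `f_N(h)`: the common value of `f_{N,V,T}(h)` for all choices of generators `V` of the rays of
`N` and all triangulations `T` of `N`
(junk value `0` if there is no triangulation or no common value). -/
def fanValue {d : ℕ} {K : Type*} [Field K] [Algebra ℝ K]
    (N : Set (Set (EuclideanSpace ℝ (Fin d)))) (h : EuclideanSpace ℝ (Fin d) → K) : K :=
  if hf : ∃ f : K, (∃ V T, IsTriangulation N V T) ∧
      ∀ V T, IsTriangulation N V T → triangulationSum T h = f
  then hf.choose else 0

/-! ### Dual mixed volume -/

/-- The linear form `h_{xP}(v) = ∑ i, x_i h_{P_i}(v)` in the variables `x_i`. -/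
def supportForm {d : ℕ} {ι : Type*} [Fintype ι] (P : ι → Set (EuclideanSpace ℝ (Fin d)))
    (v : EuclideanSpace ℝ (Fin d)) : MvPolynomial ι ℝ :=
  ∑ i, MvPolynomial.C (supportFn (P i) v) * MvPolynomial.X i

/-- The sequence `P` is regular: its Minkowski sum is full-dimensional and for some real `x` the
value `h_{xP}(v)` is non-zero for every ray `ℝ_{≥ 0} v` of the normal fan of the sum. -/
def IsRegular {d : ℕ} {ι : Type*} [Fintype ι] (P : ι → Set (EuclideanSpace ℝ (Fin d))) : Prop :=
  dim (∑ i, P i) = d ∧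
    ∃ x : ι → ℝ, ∀ v, GeneratesRay (normalFan (∑ i, P i)) v → ∑ i, x i * supportFn (P i) v ≠ 0

/-- The dual mixed volume rational function `m_P(x)` (meaningful for regular sequences). -/
def dualMixedVolume {d : ℕ} {ι : Type*} [Fintype ι] (P : ι → Set (EuclideanSpace ℝ (Fin d))) :
    FractionRing (MvPolynomial ι ℝ) :=
  if dim (∑ i, P i) = d then
    fanValue (normalFan (∑ i, P i))
      (fun v => algebraMap (MvPolynomial ι ℝ) (FractionRing (MvPolynomial ι ℝ)) (supportForm P v))
  else 0

/-- The sequence `(P_1, …, P_r, {-e_1}, …, {-e_d})`. -/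
def extendByBasis {d : ℕ} {ι : Type*} (P : ι → Set (EuclideanSpace ℝ (Fin d))) :
    ι ⊕ Fin d → Set (EuclideanSpace ℝ (Fin d)) :=
  Sum.elim P (fun j => {-EuclideanSpace.single j (1 : ℝ)})

/-- The dual mixed volume function `m_P(x, z)`: the variable `x_i` is `X (Sum.inl i)` and the
variable `z_j` is `X (Sum.inr j)`. -/
def dualMixedVolumeZ {d : ℕ} {ι : Type*} [Fintype ι] (P : ι → Set (EuclideanSpace ℝ (Fin d))) :
    FractionRing (MvPolynomial (ι ⊕ Fin d) ℝ) :=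
  dualMixedVolume (extendByBasis P)

/-! ### Fine mixed cells -/

/-- `S` is a simplex (of any dimension): the convex hull of finitely many, and at least one,
affinely independent points. -/
def IsSimplex {d : ℕ} (S : Set (EuclideanSpace ℝ (Fin d))) : Prop :=
  ∃ (n : ℕ) (s : Affine.Simplex ℝ (EuclideanSpace ℝ (Fin d)) n),
    S = convexHull ℝ (Set.range s.points)

/-- Fine mixed cells. -/
structure IsFineMixedCell {d r : ℕ} (P : Fin r → Set (EuclideanSpace ℝ (Fin d))) : Prop where
  simplex : ∀ i, IsSimplex (P i)
  sum_dim : ∑ i, dim (P i) = d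
  dim_sum : dim (∑ i, P i) = d

/-- `v i 0, …, v i d_i` are the normalised normal rays of the simplices `P_i`, `d_i = dim P_i`.
If `d_i > 0`, they lie in the cones of the normal fan of `P_i` that belong to the `d_i + 1`
different facets of `P_i`, they are normal to the affine span of `P_k` for all `k ≠ i`, and the
linear function `⟨·, v i a⟩` has width one on `P_i`. If `d_i = 0`, then `v i 0 = 0`. -/
structure IsNormalizedRays {d r : ℕ} (P : Fin r → Set (EuclideanSpace ℝ (Fin d)))
    (v : (i : Fin r) → Fin (dim (P i) + 1) → EuclideanSpace ℝ (Fin d)) : Prop where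
  eq_zero : ∀ i, dim (P i) = 0 → ∀ a, v i a = 0
  facets : ∀ i, 0 < dim (P i) →
    ∃ F : Fin (dim (P i) + 1) → Set (EuclideanSpace ℝ (Fin d)),
      Function.Injective F ∧ ∀ a, IsFacet (P i) (F a) ∧ v i a ∈ normalCone (P i) (F a)
  orthogonal : ∀ i, 0 < dim (P i) → ∀ a, ∀ k, k ≠ i →
    ∀ w ∈ vectorSpan ℝ (P k), inner ℝ w (v i a) = 0
  width : ∀ i, 0 < dim (P i) → ∀ a,
    sSup ((fun y => inner ℝ y (v i a)) '' P i) - sInf ((fun y => inner ℝ y (v i a)) '' P i) = 1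

/-- `κ(P) = |det (v_{i,j})|`, where `i` runs over `1, …, r` and `j` over the first `d_i` of the
`d_i + 1` indices belonging to `i`, in lexicographic order. -/
def kappa {d r : ℕ} {P : Fin r → Set (EuclideanSpace ℝ (Fin d))} (hP : IsFineMixedCell P)
    (v : (i : Fin r) → Fin (dim (P i) + 1) → EuclideanSpace ℝ (Fin d)) : ℝ :=
  |(Matrix.of fun s t : Fin d =>
    let p := finSigmaFinEquiv.symm (finCongr hP.sum_dim.symm s)
    v p.1 p.2.castSucc t).det|

end

end DualMixed

/-! The directions of the simplices of a fine mixed cell decompose the space as a direct sum. Hence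
each vertex $p_{i,a}$ of $P_i$ has a dual vector $v_{i,a}$: up to a constant it is the barycentric
coordinate of $p_{i,a}$ on $P_i$, and it is constant on every other $P_k$. These are exactly the
normalised normal rays (`exists_isRaySystem`, `IsFineMixedCell.exists_isRaySystem`), and $\sum_a
v_{i,a}=0$.

Every $w$ equals $\sum_{i,a}(\langle w,p_{i,a}\rangle-s_i)v_{i,a}$ for arbitrary shifts $s_i$
(`IsRaySystem.expand`). Taking $s_i=\langle w,p_{i,a_i}\rangle$ at a minimising vertex shows that
$w$ is a non-negative combination of the $v_{i,b}$ with $b\ne a_i$. So the maximal cones of the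
normal fan are indexed by tuples $(a_i)$ and are already simplicial: the triangulation is unique up
to rescaling generators, and rescaling does not change the terms of the sum. The relations $\sum_a
v_{i,a}=0$ make the generators of any two maximal cones integral combinations of each other, so all
determinants have absolute value $\kappa$.

Thus the sum over tuples factors (`IsRaySystem.fanValue_normalFan`) into
$\kappa\prod_i\sum_a\prod_{b\ne a}u(v_{i,b})^{-1}=\kappa\prod_i\bigl(\sum_a u(v_{i,a})/\prod_a
u(v_{i,a})\bigr)$, over $i$ with $d_i>0$. For $u=h_{\mathbf x\mathbf P}$ the numerator is $x_i$
(`IsRaySystem.sum_supportFn_ray`); the $\mathbf z$-part cancels because the rays of a block sum to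
zero. -/

namespace DualMixed

noncomputable section

/-! ### Minimisers of linear functions on Minkowski sums of polytopes -/

/-- The points of `S` at which `⟨w, ·⟩` attains its minimum over `S`. -/
def argmin {d : ℕ} (S : Set (EuclideanSpace ℝ (Fin d))) (w : EuclideanSpace ℝ (Fin d)) :
    Set (EuclideanSpace ℝ (Fin d)) :=
  {x | x ∈ S ∧ ∀ z ∈ S, (inner ℝ w x : ℝ) ≤ inner ℝ w z}

theorem mem_normalCone_argmin {d : ℕ} {S : Set (EuclideanSpace ℝ (Fin d))}
    {u w : EuclideanSpace ℝ (Fin d)} :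
    w ∈ normalCone S (argmin S u) ↔ argmin S u ⊆ argmin S w :=
  ⟨fun h y hy => ⟨hy.1, h y hy⟩, fun h _ hy => (h hy).2⟩

theorem isFace_argmin {d : ℕ} {S : Set (EuclideanSpace ℝ (Fin d))}
    {w : EuclideanSpace ℝ (Fin d)} (h : (argmin S w).Nonempty) : IsFace S (argmin S w) := by
  obtain ⟨x₀, hx₀, hmin⟩ := h
  -- `IsFace` is phrased with maxima, `argmin` with minima; hence the sign.
  refine ⟨⟨x₀, hx₀, hmin⟩, fun x hx => hx.1, -w, -inner ℝ w x₀, fun x hx => ?_, fun x hx => ?_⟩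
  · rw [inner_neg_right, real_inner_comm, le_antisymm (hx.2 _ hx₀) (hmin _ hx.1)]
  · rw [inner_neg_right, real_inner_comm, neg_lt_neg_iff]
    by_contra hlt
    exact hx.2 ⟨hx.1, fun z hz => (not_lt.1 hlt).trans (hmin z hz)⟩

theorem IsFace.exists_eq_argmin {d : ℕ} {S F : Set (EuclideanSpace ℝ (Fin d))} (h : IsFace S F) :
    ∃ u, F = argmin S u := by
  obtain ⟨⟨x₀, hx₀⟩, hFS, y, b, hb, hlt⟩ := h
  have hle : ∀ x ∈ S, inner ℝ x y ≤ b := fun x hx => by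
    by_cases hxF : x ∈ F
    · exact (hb x hxF).le
    · exact (hlt x ⟨hx, hxF⟩).le
  refine ⟨-y, Set.ext fun x => ⟨fun hx => ⟨hFS hx, fun z hz => ?_⟩, fun hx => ?_⟩⟩
  · have := hle z hz
    have := hb x hx
    rw [inner_neg_left, inner_neg_left, real_inner_comm, real_inner_comm z]
    linarith
  · by_contra hxF
    have h1 := hlt x ⟨hx.1, hxF⟩
    have h2 := hx.2 x₀ (hFS hx₀)
    have h3 := hb x₀ hx₀
    rw [inner_neg_left, inner_neg_left, real_inner_comm, real_inner_comm x₀] at h2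
    linarith

theorem supportFn_eq_of_mem_argmin {d : ℕ} {S : Set (EuclideanSpace ℝ (Fin d))}
    {w y : EuclideanSpace ℝ (Fin d)} (h : y ∈ argmin S w) : supportFn S w = -inner ℝ w y := by
  have : IsLeast ((fun y => inner ℝ w y) '' S) (inner ℝ w y : ℝ) :=
    ⟨⟨y, h.1, rfl⟩, by rintro _ ⟨z, hz, rfl⟩; exact h.2 z hz⟩
  rw [supportFn, this.csInf_eq]

theorem supportFn_smul {d : ℕ} {S : Set (EuclideanSpace ℝ (Fin d))}
    {t : ℝ} (ht : 0 ≤ t) (w : EuclideanSpace ℝ (Fin d)) :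
    supportFn S (t • w) = t * supportFn S w := by
  have : (fun y => (inner ℝ (t • w) y : ℝ)) '' S = t • ((fun y => (inner ℝ w y : ℝ)) '' S) := by
    rw [← Set.image_smul, Set.image_image]
    simp [real_inner_smul_left]
  rw [supportFn, this, Real.sInf_smul_of_nonneg ht, supportFn, smul_eq_mul, mul_neg]

/-- A point of `∑ i, S i` minimises `⟨w, ·⟩` if and only if all its summands do. -/
theorem sum_mem_argmin_iff {d r : ℕ} {S : Fin r → Set (EuclideanSpace ℝ (Fin d))}
    {w : EuclideanSpace ℝ (Fin d)} {y : Fin r → EuclideanSpace ℝ (Fin d)} (hy : ∀ i, y i ∈ S i) :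
    ∑ i, y i ∈ argmin (∑ i, S i) w ↔ ∀ i, y i ∈ argmin (S i) w := by
  constructor
  · intro h i
    refine ⟨hy i, fun z hz => ?_⟩
    have hmem : ∑ k, Function.update y i z k ∈ ∑ k, S k := by
      rw [Set.mem_fintype_sum]
      refine ⟨_, fun k => ?_, rfl⟩
      by_cases hk : k = i
      · subst hk; simpa using hz
      · simpa [hk] using hy k
    have h1 := h.2 _ hmem
    rw [Finset.sum_update_of_mem (Finset.mem_univ i),
      Finset.sum_eq_add_sum_sdiff_singleton_of_mem (Finset.mem_univ i), inner_add_right,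
      inner_add_right] at h1
    linarith
  · intro h
    refine ⟨(Set.mem_fintype_sum _ _).2 ⟨y, hy, rfl⟩, fun z hz => ?_⟩
    obtain ⟨g, hg, rfl⟩ := (Set.mem_fintype_sum _ _).1 hz
    rw [inner_sum, inner_sum]
    exact Finset.sum_le_sum fun i _ => (h i).2 _ (hg i)

/-- The vertex `p a` minimises `⟨w, ·⟩` among the points `p b`. -/
def IsMinAt {d n : ℕ} (p : Fin (n + 1) → EuclideanSpace ℝ (Fin d)) (w : EuclideanSpace ℝ (Fin d))
    (a : Fin (n + 1)) : Prop :=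
  ∀ b, (inner ℝ w (p a) : ℝ) ≤ inner ℝ w (p b)

theorem exists_isMinAt {d n : ℕ} (p : Fin (n + 1) → EuclideanSpace ℝ (Fin d))
    (w : EuclideanSpace ℝ (Fin d)) : ∃ a, IsMinAt p w a :=
  Finite.exists_min _

theorem mem_convexHull_range_iff {d n : ℕ} {p : Fin n → EuclideanSpace ℝ (Fin d)}
    {x : EuclideanSpace ℝ (Fin d)} : x ∈ convexHull ℝ (Set.range p) ↔
      ∃ c : Fin n → ℝ, (∀ a, 0 ≤ c a) ∧ ∑ a, c a = 1 ∧ ∑ a, c a • p a = x := by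
  constructor
  · rw [convexHull_range_eq_exists_affineCombination]
    rintro ⟨s, c, h0, h1, rfl⟩
    refine ⟨fun a => if a ∈ s then c a else 0, fun a => ?_, ?_, ?_⟩
    · dsimp only; split_ifs with h
      exacts [h0 a h, le_rfl]
    · simpa using h1
    · rw [s.affineCombination_eq_linear_combination _ _ h1]
      simp [ite_smul]
  · rintro ⟨c, h0, h1, rfl⟩
    exact mem_convexHull_of_exists_fintype c p h0 h1 (fun a => ⟨a, rfl⟩) rfl

theorem mem_argmin_convexHull_iff {d n : ℕ} {p : Fin (n + 1) → EuclideanSpace ℝ (Fin d)}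
    {w : EuclideanSpace ℝ (Fin d)} {a : Fin (n + 1)} :
    p a ∈ argmin (convexHull ℝ (Set.range p)) w ↔ IsMinAt p w a := by
  constructor
  · exact fun h b => h.2 _ (subset_convexHull _ _ ⟨b, rfl⟩)
  · refine fun h => ⟨subset_convexHull _ _ ⟨a, rfl⟩, fun z hz => ?_⟩
    obtain ⟨c, h0, h1, rfl⟩ := mem_convexHull_range_iff.1 hz
    calc (inner ℝ w (p a) : ℝ) = ∑ b, c b * inner ℝ w (p a) := by rw [← Finset.sum_mul, h1, one_mul]
      _ ≤ ∑ b, c b * inner ℝ w (p b) :=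
        Finset.sum_le_sum fun b _ => mul_le_mul_of_nonneg_left (h b) (h0 b)
      _ = _ := by simp [inner_sum, real_inner_smul_right]

theorem argmin_nonempty {d n : ℕ} (p : Fin (n + 1) → EuclideanSpace ℝ (Fin d))
    (w : EuclideanSpace ℝ (Fin d)) : (argmin (convexHull ℝ (Set.range p)) w).Nonempty := by
  obtain ⟨a, ha⟩ := exists_isMinAt p w
  exact ⟨_, mem_argmin_convexHull_iff.2 ha⟩

/-- A minimiser is a convex combination of minimising vertices. -/
theorem exists_combination_of_mem_argmin {d n : ℕ} {p : Fin (n + 1) → EuclideanSpace ℝ (Fin d)}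
    {w x : EuclideanSpace ℝ (Fin d)} (hx : x ∈ argmin (convexHull ℝ (Set.range p)) w) :
    ∃ c : Fin (n + 1) → ℝ, (∀ a, 0 ≤ c a) ∧ ∑ a, c a = 1 ∧ ∑ a, c a • p a = x ∧
      ∀ a, ¬ IsMinAt p w a → c a = 0 := by
  obtain ⟨c, h0, h1, rfl⟩ := mem_convexHull_range_iff.1 hx.1
  refine ⟨c, h0, h1, rfl, fun a ha => ?_⟩
  obtain ⟨a₀, ha₀⟩ := exists_isMinAt p w
  have hle := hx.2 _ (subset_convexHull ℝ _ ⟨a₀, rfl⟩)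
  -- A weighted sum of the non-negative gaps to the minimum is at most zero, so weight sits only on
  -- vertices with zero gap.
  have hsum : ∑ b, c b * ((inner ℝ w (p b) : ℝ) - inner ℝ w (p a₀)) ≤ 0 := by
    simp only [mul_sub, Finset.sum_sub_distrib, ← Finset.sum_mul, h1]
    simp only [inner_sum, real_inner_smul_right] at hle
    linarith
  have hnn : ∀ b ∈ Finset.univ, 0 ≤ c b * ((inner ℝ w (p b) : ℝ) - inner ℝ w (p a₀)) :=
    fun b _ => mul_nonneg (h0 b) (sub_nonneg.2 (ha₀ b))
  have hz := (Finset.sum_eq_zero_iff_of_nonneg hnn).1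
    (le_antisymm hsum (Finset.sum_nonneg hnn)) a (Finset.mem_univ a)
  refine (mul_eq_zero.1 hz).resolve_right fun h => ha fun b => ?_
  rw [sub_eq_zero.1 h]
  exact ha₀ b

theorem mem_argmin_of_combination {d n : ℕ} {p : Fin (n + 1) → EuclideanSpace ℝ (Fin d)}
    {w : EuclideanSpace ℝ (Fin d)} {c : Fin (n + 1) → ℝ} (h0 : ∀ a, 0 ≤ c a) (h1 : ∑ a, c a = 1)
    (hc : ∀ a, ¬ IsMinAt p w a → c a = 0) :
    ∑ a, c a • p a ∈ argmin (convexHull ℝ (Set.range p)) w := by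
  refine ⟨mem_convexHull_range_iff.2 ⟨c, h0, h1, rfl⟩, ?_⟩
  obtain ⟨a₀, ha₀⟩ := exists_isMinAt p w
  have : (inner ℝ w (∑ a, c a • p a) : ℝ) = inner ℝ w (p a₀) := by
    simp only [inner_sum, real_inner_smul_right]
    calc ∑ b, c b * (inner ℝ w (p b) : ℝ) = ∑ b, c b * inner ℝ w (p a₀) := by
          refine Finset.sum_congr rfl fun b _ => ?_
          by_cases hb : IsMinAt p w b
          · rw [le_antisymm (hb a₀) (ha₀ b)]
          · rw [hc b hb, zero_mul, zero_mul]
      _ = _ := by rw [← Finset.sum_mul, h1, one_mul]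
  rw [this]
  exact (mem_argmin_convexHull_iff.2 ha₀).2

/-- The cone of all vectors minimised by all the vertices that minimise `u`. -/
def minCone {d r : ℕ} {m : Fin r → ℕ} (p : ∀ i, Fin (m i + 1) → EuclideanSpace ℝ (Fin d))
    (u : EuclideanSpace ℝ (Fin d)) : Set (EuclideanSpace ℝ (Fin d)) :=
  {w | ∀ i a, IsMinAt (p i) u a → IsMinAt (p i) w a}

/-- Minimisers of the sum are sums of minimisers, and these are convex combinations of minimising
vertices. The normal fan therefore depends only on which vertices are minimal. -/
theorem normalCone_argmin_eq_minCone {d r : ℕ} {m : Fin r → ℕ}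
    (p : ∀ i, Fin (m i + 1) → EuclideanSpace ℝ (Fin d)) (u : EuclideanSpace ℝ (Fin d)) :
    normalCone (∑ i, convexHull ℝ (Set.range (p i)))
      (argmin (∑ i, convexHull ℝ (Set.range (p i))) u) = minCone p u := by
  ext w
  rw [mem_normalCone_argmin]
  constructor
  · intro h i a ha
    choose a₀ ha₀ using fun k => exists_isMinAt (p k) u
    have hmin : ∀ k, IsMinAt (p k) u (Function.update a₀ i a k) := by
      intro k
      by_cases hk : k = i
      · subst hk; simpa using ha
      · simpa [hk] using ha₀ k
    have hmem : ∀ k, p k (Function.update a₀ i a k) ∈ convexHull ℝ (Set.range (p k)) :=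
      fun k => subset_convexHull _ _ ⟨_, rfl⟩
    have := (sum_mem_argmin_iff hmem).1 (h ((sum_mem_argmin_iff hmem).2
      fun k => mem_argmin_convexHull_iff.2 (hmin k))) i
    simpa using mem_argmin_convexHull_iff.1 this
  · intro h y hy
    obtain ⟨g, hg, rfl⟩ := (Set.mem_fintype_sum _ _).1 hy.1
    refine (sum_mem_argmin_iff hg).2 fun i => ?_
    obtain ⟨c, h0, h1, hgi, hc⟩ :=
      exists_combination_of_mem_argmin ((sum_mem_argmin_iff hg).1 hy i)
    rw [← hgi]
    exact mem_argmin_of_combination h0 h1 fun a ha => hc a fun hu => ha (h i a hu)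

theorem argmin_sum_nonempty {d r : ℕ} {m : Fin r → ℕ}
    (p : ∀ i, Fin (m i + 1) → EuclideanSpace ℝ (Fin d)) (u : EuclideanSpace ℝ (Fin d)) :
    (argmin (∑ i, convexHull ℝ (Set.range (p i))) u).Nonempty := by
  choose a ha using fun k => exists_isMinAt (p k) u
  exact ⟨∑ i, p i (a i), (sum_mem_argmin_iff fun k => subset_convexHull _ _ (Set.mem_range_self _)).2
    fun k => mem_argmin_convexHull_iff.2 (ha k)⟩

theorem mem_normalFan_iff {d r : ℕ} {m : Fin r → ℕ}
    (p : ∀ i, Fin (m i + 1) → EuclideanSpace ℝ (Fin d)) (C : Set (EuclideanSpace ℝ (Fin d))) :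
    C ∈ normalFan (∑ i, convexHull ℝ (Set.range (p i))) ↔ ∃ u, C = minCone p u := by
  constructor
  · rintro ⟨F, hF, rfl⟩
    obtain ⟨u, rfl⟩ := hF.exists_eq_argmin
    exact ⟨u, normalCone_argmin_eq_minCone p u⟩
  · rintro ⟨u, rfl⟩
    exact ⟨_, isFace_argmin (argmin_sum_nonempty p u), (normalCone_argmin_eq_minCone p u).symm⟩

/-- Translation moves all sets of minimisers along, so the cones do not change. This disposes of the
summands $\{-e_j\}$. -/
theorem normalFan_subset_add_singleton {d : ℕ} (S : Set (EuclideanSpace ℝ (Fin d)))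
    (t : EuclideanSpace ℝ (Fin d)) : normalFan S ⊆ normalFan (S + {t}) := by
  rintro _ ⟨F, hF, rfl⟩
  obtain ⟨u, rfl⟩ := hF.exists_eq_argmin
  have key : ∀ w, argmin (S + {t}) w = argmin S w + {t} := by
    intro w
    ext x
    rw [Set.add_singleton, Set.add_singleton]
    constructor
    · rintro ⟨⟨y, hy, rfl⟩, h⟩
      refine ⟨y, ⟨hy, fun z hz => ?_⟩, rfl⟩
      simpa [inner_add_right] using h (z + t) ⟨z, hz, rfl⟩
    · rintro ⟨y, ⟨hy, h⟩, rfl⟩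
      refine ⟨⟨y, hy, rfl⟩, ?_⟩
      rintro _ ⟨z, hz, rfl⟩
      simpa [inner_add_right] using h z hz
  refine ⟨argmin (S + {t}) u, isFace_argmin ?_, ?_⟩
  · rw [key]
    exact hF.1.add (Set.singleton_nonempty t)
  · ext w
    rw [mem_normalCone_argmin, mem_normalCone_argmin, key, key, Set.add_singleton,
      Set.add_singleton, Set.image_subset_image_iff (add_left_injective t)]

theorem normalFan_add_singleton {d : ℕ} (S : Set (EuclideanSpace ℝ (Fin d)))
    (t : EuclideanSpace ℝ (Fin d)) : normalFan (S + {t}) = normalFan S := by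
  refine (normalFan_subset_add_singleton S t).antisymm' ?_
  have h := normalFan_subset_add_singleton (S + {t}) (-t)
  rwa [add_assoc, Set.singleton_add_singleton, add_neg_cancel, Set.singleton_zero, add_zero] at h

/-! ### The normal fan of a transversal sum of simplices -/

theorem isMinAt_smul_iff {d n : ℕ} {p : Fin (n + 1) → EuclideanSpace ℝ (Fin d)}
    {w : EuclideanSpace ℝ (Fin d)} {a : Fin (n + 1)} {t : ℝ} (ht : 0 < t) :
    IsMinAt p (t • w) a ↔ IsMinAt p w a := by
  simp [IsMinAt, real_inner_smul_left, mul_le_mul_iff_right₀ ht]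

/-- The points `p i a` are the vertices of simplices whose directions span the space as a direct
sum, and `⟨v i a, ·⟩` is, up to a constant, the barycentric coordinate of `p i a`. -/
structure IsRaySystem {d r : ℕ} {m : Fin r → ℕ}
    (p v : ∀ i, Fin (m i + 1) → EuclideanSpace ℝ (Fin d)) : Prop where
  inner_ne : ∀ i a k, k ≠ i → ∀ b c, (inner ℝ (v i a) (p k b) : ℝ) = inner ℝ (v i a) (p k c)
  inner_self : ∀ i a b c, (inner ℝ (v i a) (p i b) : ℝ) - inner ℝ (v i a) (p i c) =
    (if b = a then 1 else 0) - (if c = a then 1 else 0)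
  eq_zero : ∀ w, (∀ k b c, (inner ℝ w (p k b) : ℝ) = inner ℝ w (p k c)) → w = 0
  sum_eq : ∑ i, m i = d

/-- The rays spanning the cone of the vertex `∑ i, p i (a i)`. -/
def cellRays {d r : ℕ} {m : Fin r → ℕ} (g : ∀ i, Fin (m i + 1) → EuclideanSpace ℝ (Fin d))
    (a : ∀ i, Fin (m i + 1)) (x : Σ i, Fin (m i)) : EuclideanSpace ℝ (Fin d) :=
  g x.1 ((a x.1).succAbove x.2)

open Classical in
/-- The set of the rays spanning the cone of the vertex `∑ i, p i (a i)`. -/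
def cellSet {d r : ℕ} {m : Fin r → ℕ} (g : ∀ i, Fin (m i + 1) → EuclideanSpace ℝ (Fin d))
    (a : ∀ i, Fin (m i + 1)) : Finset (EuclideanSpace ℝ (Fin d)) :=
  Finset.univ.image (cellRays g a)

namespace IsRaySystem

variable {d r : ℕ} {m : Fin r → ℕ} {p v : ∀ i, Fin (m i + 1) → EuclideanSpace ℝ (Fin d)}

/-- By duality both sides have the same differences on the vertices of each simplex, and `eq_zero`
says that these differences determine a vector. The freedom in `s` is what later arguments exploit.
-/
theorem expand (h : IsRaySystem p v) (w : EuclideanSpace ℝ (Fin d)) (s : Fin r → ℝ) :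
    w = ∑ i, ∑ a, ((inner ℝ w (p i a) : ℝ) - s i) • v i a := by
  rw [← sub_eq_zero]
  refine h.eq_zero _ fun k b c => ?_
  rw [← sub_eq_zero, ← inner_sub_right, inner_sub_left, sum_inner,
    Finset.sum_eq_single k, sum_inner]
  · have : ∀ a, (inner ℝ (((inner ℝ w (p k a) : ℝ) - s k) • v k a) (p k b - p k c) : ℝ) =
        (inner ℝ w (p k a) - s k) * ((if b = a then 1 else 0) - (if c = a then 1 else 0)) :=
      fun a => by rw [real_inner_smul_left, inner_sub_right, h.inner_self]
    simp only [this, mul_sub, Finset.sum_sub_distrib, mul_ite, mul_one, mul_zero,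
      Finset.sum_ite_eq, Finset.mem_univ, if_true, inner_sub_right]
    ring
  · intro i _ hi
    rw [sum_inner]
    refine Finset.sum_eq_zero fun a _ => ?_
    rw [real_inner_smul_left, inner_sub_right, h.inner_ne i a k hi.symm b c, sub_self, mul_zero]
  · exact fun hk => (hk (Finset.mem_univ k)).elim

theorem sum_ray (h : IsRaySystem p v) (i : Fin r) : ∑ a, v i a = 0 := by
  -- These shifts make every coefficient in block `i` equal to 1 and all others 0.
  have := h.expand 0 (fun k => if k = i then -1 else 0)
  rw [Finset.sum_eq_single i] at this
  · simpa using this.symm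
  · intro k _ hk
    simp [hk]
  · exact fun hk => (hk (Finset.mem_univ i)).elim

theorem isMinAt_ray_of_ne (h : IsRaySystem p v) {i k : Fin r} (hk : k ≠ i) (a : Fin (m i + 1))
    (b : Fin (m k + 1)) : IsMinAt (p k) (v i a) b :=
  fun c => (h.inner_ne i a k hk b c).le

theorem isMinAt_ray_of_ne' (h : IsRaySystem p v) {i : Fin r} {a b : Fin (m i + 1)} (hb : b ≠ a) :
    IsMinAt (p i) (v i a) b := by
  intro c
  have := h.inner_self i a b c
  rw [if_neg hb] at this
  split_ifs at this <;> linarith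

theorem not_isMinAt_ray (h : IsRaySystem p v) {i : Fin r} (hi : 0 < m i) (a : Fin (m i + 1)) :
    ¬ IsMinAt (p i) (v i a) a := by
  intro hmin
  have : Nontrivial (Fin (m i + 1)) := Fin.nontrivial_iff_two_le.2 (by omega)
  obtain ⟨b, hb⟩ := exists_ne a
  have h1 := h.inner_self i a a b
  have h2 := hmin b
  rw [if_pos rfl, if_neg hb] at h1
  linarith

theorem ray_eq_zero (h : IsRaySystem p v) {i : Fin r} (hi : m i = 0) (a : Fin (m i + 1)) :
    v i a = 0 := by
  refine h.eq_zero _ fun k b c => ?_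
  by_cases hk : k = i
  · subst hk
    have : b = c := Fin.ext (by omega)
    rw [this]
  · exact h.inner_ne i a k hk b c

theorem ray_ne_zero (h : IsRaySystem p v) {i : Fin r} (hi : 0 < m i) (a : Fin (m i + 1)) :
    v i a ≠ 0 := by
  intro h0
  refine h.not_isMinAt_ray hi a ?_
  rw [h0]
  exact fun b => by simp

/-- The vertices `p k b` with `(k, b) ≠ (i, a)` minimise `v i a`. -/
theorem eq_of_not_isMinAt_ray (h : IsRaySystem p v) {i k : Fin r} {a : Fin (m i + 1)}
    {b : Fin (m k + 1)} (hn : ¬ IsMinAt (p k) (v i a) b) :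
    (⟨k, b⟩ : Σ i, Fin (m i + 1)) = ⟨i, a⟩ := by
  by_cases hk : k = i
  · subst hk
    by_contra hb
    exact hn (h.isMinAt_ray_of_ne' fun hba => hb (by rw [hba]))
  · exact (hn (h.isMinAt_ray_of_ne hk a b)).elim

theorem smul_ray_eq (h : IsRaySystem p v) {i k : Fin r} (hi : 0 < m i) {a : Fin (m i + 1)}
    {b : Fin (m k + 1)} {s t : ℝ} (hs : 0 < s) (ht : 0 < t) (heq : s • v i a = t • v k b) :
    (⟨i, a⟩ : Σ i, Fin (m i + 1)) = ⟨k, b⟩ := by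
  apply h.eq_of_not_isMinAt_ray
  rw [← isMinAt_smul_iff ht, ← heq, isMinAt_smul_iff hs]
  exact h.not_isMinAt_ray hi a

/-- The vector $-\sum_k v_{k,a_k}$ is, up to constants, minus the indicator of the chosen vertices.
Such generic vectors separate the maximal cones. -/
theorem exists_isMinAt_iff (h : IsRaySystem p v) (a : ∀ i, Fin (m i + 1)) :
    ∃ w, ∀ i b, IsMinAt (p i) w b ↔ b = a i := by
  have key : ∀ i b c, (inner ℝ (-∑ k, v k (a k)) (p i b) : ℝ) -
      inner ℝ (-∑ k, v k (a k)) (p i c) =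
      (if c = a i then 1 else 0) - (if b = a i then 1 else 0) := by
    intro i b c
    have h0 := h.inner_self i (a i) b c
    rw [← inner_sub_right] at h0
    rw [← inner_sub_right, inner_neg_left, sum_inner, Finset.sum_eq_single i, h0, neg_sub]
    · intro k _ hk
      rw [inner_sub_right, h.inner_ne k (a k) i hk.symm b c, sub_self]
    · exact fun hk => (hk (Finset.mem_univ i)).elim
  refine ⟨-∑ k, v k (a k), fun i b => ⟨fun hb => ?_, ?_⟩⟩
  · by_contra hne
    have h1 := key i b (a i)
    have h2 := hb (a i)
    rw [if_pos rfl, if_neg hne] at h1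
    linarith
  · rintro rfl c
    have h1 := key i (a i) c
    rw [if_pos rfl] at h1
    split_ifs at h1 <;> linarith

/-! #### Rays of the normal fan -/

/-- If every vertex except $p_{i,a}$ is minimal for $w$, then $w$ is constant on each other simplex
and on the facet opposite $p_{i,a}$. With these constants as shifts, `expand` leaves only the term
of $v_{i,a}$. -/
theorem minCone_ray (h : IsRaySystem p v) {i : Fin r} (hi : 0 < m i) (a : Fin (m i + 1)) :
    minCone p (v i a) = rayOf (v i a) := by
  have : Nontrivial (Fin (m i + 1)) := Fin.nontrivial_iff_two_le.2 (by omega)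
  obtain ⟨b, hb⟩ := exists_ne a
  ext w
  constructor
  · intro hw
    have hmin := hw i b (h.isMinAt_ray_of_ne' hb)
    refine ⟨inner ℝ w (p i a) - inner ℝ w (p i b), sub_nonneg.2 (hmin a), ?_⟩
    have hexp := h.expand w
      (fun k => if hk : k = i then (inner ℝ w (p i b) : ℝ) else inner ℝ w (p k 0))
    rw [Finset.sum_eq_single i, Finset.sum_eq_single a] at hexp
    · simpa using hexp
    · intro c _ hc
      have := hw i c (h.isMinAt_ray_of_ne' hc) b
      simp [le_antisymm this (hmin c)]
    · exact fun hk => (hk (Finset.mem_univ a)).elim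
    · intro k _ hk
      refine Finset.sum_eq_zero fun c _ => ?_
      have h1 := hw k c (h.isMinAt_ray_of_ne hk a c) 0
      have h2 := hw k 0 (h.isMinAt_ray_of_ne hk a 0) c
      simp [hk, le_antisymm h1 h2]
    · exact fun hk => (hk (Finset.mem_univ i)).elim
  · rintro ⟨t, ht, rfl⟩ k c hc
    rcases ht.eq_or_lt with rfl | ht
    · intro b; simp
    · exact (isMinAt_smul_iff ht).2 hc

/-- If a cone `minCone p u` is a ray, some vertex $p_{i,a}$ is not minimal for `u`. It is the only
vertex that can fail to be minimal for $v_{i,a}$, so $v_{i,a}$ lies in the cone and spans it. -/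
theorem generatesRay_iff (h : IsRaySystem p v) {x : EuclideanSpace ℝ (Fin d)} :
    GeneratesRay (normalFan (∑ i, convexHull ℝ (Set.range (p i)))) x ↔
      ∃ (i : Fin r) (a : Fin (m i + 1)) (s : ℝ), 0 < m i ∧ 0 < s ∧ x = s • v i a := by
  rw [GeneratesRay, mem_normalFan_iff]
  constructor
  · rintro ⟨hx, u, hu⟩
    have hxu : x ∈ minCone p u := by
      rw [← hu]; exact ⟨1, zero_le_one, (one_smul _ _).symm⟩
    have : ∃ k b, ¬ IsMinAt (p k) u b := by
      by_contra! hall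
      exact hx (h.eq_zero _ fun k b c => le_antisymm (hxu k b (hall k b) c) (hxu k c (hall k c) b))
    obtain ⟨i, a, hia⟩ := this
    obtain ⟨b, hb⟩ := exists_isMinAt (p i) u
    have hba : b ≠ a := fun hba => hia (hba ▸ hb)
    have hi : 0 < m i := by
      by_contra h0
      exact hba (Fin.ext (by omega))
    have hmem : v i a ∈ minCone p u := by
      intro k c hc
      by_contra hn
      have := h.eq_of_not_isMinAt_ray hn
      cases this
      exact hia hc
    rw [← hu] at hmem
    obtain ⟨t, ht, hv⟩ := hmem
    have ht : 0 < t := ht.lt_of_ne fun h0 => h.ray_ne_zero hi a (by rw [hv, ← h0, zero_smul])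
    exact ⟨i, a, t⁻¹, hi, inv_pos.2 ht, by rw [hv, smul_smul, inv_mul_cancel₀ ht.ne', one_smul]⟩
  · rintro ⟨i, a, s, hi, hs, rfl⟩
    refine ⟨smul_ne_zero hs.ne' (h.ray_ne_zero hi a), v i a, ?_⟩
    rw [h.minCone_ray hi]
    ext w
    constructor
    · rintro ⟨t, ht, rfl⟩
      exact ⟨t * s, mul_nonneg ht hs.le, smul_smul _ _ _⟩
    · rintro ⟨t, ht, rfl⟩
      exact ⟨t / s, div_nonneg ht hs.le, by rw [smul_smul, div_mul_cancel₀ _ hs.ne']⟩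

/-! #### Maximal cones -/

/-- Shifting by the value at the vertex `a i` removes the one ray of block `i` missing from the
cone. The coefficients are non-negative when these vertices minimise `w`; the scales `t` account for
an arbitrary choice of generators. -/
theorem sum_smul_cellRays (h : IsRaySystem p v) {t : ∀ i, Fin (m i + 1) → ℝ}
    (ht : ∀ i a, 0 < t i a) (a : ∀ i, Fin (m i + 1)) (w : EuclideanSpace ℝ (Fin d)) :
    ∑ x : Σ i, Fin (m i), (((inner ℝ w (p x.1 ((a x.1).succAbove x.2)) : ℝ) -
      inner ℝ w (p x.1 (a x.1))) / t x.1 ((a x.1).succAbove x.2)) •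
        cellRays (fun i b => t i b • v i b) a x = w := by
  conv_rhs => rw [h.expand w fun i => inner ℝ w (p i (a i))]
  rw [Fintype.sum_sigma]
  refine Finset.sum_congr rfl fun i _ => ?_
  rw [Fin.sum_univ_succAbove _ (a i), sub_self, zero_smul, zero_add]
  refine Finset.sum_congr rfl fun j _ => ?_
  rw [cellRays, smul_smul, div_mul_cancel₀ _ (ht _ _).ne']

theorem card_sigma (h : IsRaySystem p v) : Fintype.card (Σ i, Fin (m i)) = d := by
  simp [h.sum_eq]

theorem linearIndependent_cellRays (h : IsRaySystem p v) {t : ∀ i, Fin (m i + 1) → ℝ}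
    (ht : ∀ i a, 0 < t i a) (a : ∀ i, Fin (m i + 1)) :
    LinearIndependent ℝ (cellRays (fun i b => t i b • v i b) a) := by
  apply linearIndependent_of_top_le_span_of_card_eq_finrank
  · intro w _
    rw [← h.sum_smul_cellRays ht a w]
    exact Submodule.sum_mem _ fun x _ => Submodule.smul_mem _ _ (Submodule.subset_span ⟨x, rfl⟩)
  · rw [h.card_sigma, finrank_euclideanSpace_fin]

theorem card_cellSet (h : IsRaySystem p v) {t : ∀ i, Fin (m i + 1) → ℝ}
    (ht : ∀ i a, 0 < t i a) (a : ∀ i, Fin (m i + 1)) :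
    (cellSet (fun i b => t i b • v i b) a).card = d := by
  rw [cellSet, Finset.card_image_of_injective _ (h.linearIndependent_cellRays ht a).injective,
    Finset.card_univ, h.card_sigma]

theorem isMinAt_of_mem_cellSet (h : IsRaySystem p v) {t : ∀ i, Fin (m i + 1) → ℝ}
    (ht : ∀ i a, 0 < t i a) {a : ∀ i, Fin (m i + 1)} {x : EuclideanSpace ℝ (Fin d)}
    (hx : x ∈ cellSet (fun i b => t i b • v i b) a) (i : Fin r) : IsMinAt (p i) x (a i) := by
  rw [cellSet, Finset.mem_image] at hx
  obtain ⟨⟨k, j⟩, -, rfl⟩ := hx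
  rw [cellRays, isMinAt_smul_iff (ht _ _)]
  by_contra hn
  obtain ⟨rfl, h2⟩ := Sigma.mk.inj_iff.1 (h.eq_of_not_isMinAt_ray hn)
  exact Fin.succAbove_ne _ _ (eq_of_heq h2).symm

theorem mem_coneOf_cellSet_iff (h : IsRaySystem p v) {t : ∀ i, Fin (m i + 1) → ℝ}
    (ht : ∀ i a, 0 < t i a) {a : ∀ i, Fin (m i + 1)} {w : EuclideanSpace ℝ (Fin d)} :
    w ∈ coneOf (cellSet (fun i b => t i b • v i b) a) ↔ ∀ i, IsMinAt (p i) w (a i) := by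
  constructor
  · intro hw i
    refine Submodule.span_induction (p := fun w _ => IsMinAt (p i) w (a i)) ?_ ?_ ?_ ?_ hw
    · exact fun x hx => h.isMinAt_of_mem_cellSet ht hx i
    · intro b; simp
    · intro x y _ _ hx hy b
      rw [inner_add_left, inner_add_left]
      exact add_le_add (hx b) (hy b)
    · intro c x _ hx b
      rw [Nonneg.mk_smul c.1 c.2, real_inner_smul_left, real_inner_smul_left]
      exact mul_le_mul_of_nonneg_left (hx b) c.2
  · intro hw
    rw [← h.sum_smul_cellRays ht a w]
    refine Submodule.sum_mem _ fun x _ => ?_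
    exact Submodule.smul_mem _ (⟨_, div_nonneg (sub_nonneg.2 (hw _ _)) (ht _ _).le⟩ : {c : ℝ // 0 ≤ c})
      (Submodule.subset_span (by
        rw [cellSet, Finset.coe_image]
        exact ⟨x, Finset.mem_coe.2 (Finset.mem_univ x), rfl⟩))

theorem cellSet_injective (h : IsRaySystem p v) {t : ∀ i, Fin (m i + 1) → ℝ}
    (ht : ∀ i a, 0 < t i a) : Function.Injective (cellSet (fun i b => t i b • v i b)) := by
  intro a b hab
  obtain ⟨w, hw⟩ := h.exists_isMinAt_iff a
  have h1 : w ∈ coneOf (cellSet (fun i b => t i b • v i b) a) :=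
    (h.mem_coneOf_cellSet_iff ht).2 fun i => (hw i _).2 rfl
  rw [hab, h.mem_coneOf_cellSet_iff ht] at h1
  exact funext fun i => ((hw i _).1 (h1 i)).symm

end IsRaySystem

/-! ### Absolute determinants of families of vectors -/

/-- `|det|` of a family of `d` vectors indexed by a type equivalent to `Fin d`. -/
def absDetFamily {d : ℕ} {J : Type*} (e : J ≃ Fin d) (f : J → EuclideanSpace ℝ (Fin d)) : ℝ :=
  |(Matrix.of fun s t : Fin d => f (e.symm s) t).det|

theorem absDetFamily_congr {d : ℕ} {J : Type*} (e e' : J ≃ Fin d)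
    (f : J → EuclideanSpace ℝ (Fin d)) : absDetFamily e f = absDetFamily e' f := by
  have : (Matrix.of fun s t : Fin d => f (e.symm s) t) =
      (Matrix.of fun s t : Fin d => f (e'.symm s) t).submatrix (e.symm.trans e') id := by
    ext s t
    simp
  rw [absDetFamily, absDetFamily, this, Matrix.det_permute, abs_mul, ← Int.cast_abs]
  simp

theorem absDet_image {d : ℕ} {J : Type*} [Fintype J] (e : J ≃ Fin d)
    {f : J → EuclideanSpace ℝ (Fin d)} (hf : Function.Injective f)
    {σ : Finset (EuclideanSpace ℝ (Fin d))} (hσ : ∀ x, x ∈ σ ↔ ∃ j, f j = x) :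
    absDet σ = absDetFamily e f := by
  let E : J ≃ {x // x ∈ σ} := Equiv.ofBijective (fun j => ⟨f j, (hσ _).2 ⟨j, rfl⟩⟩)
    ⟨fun a b hab => hf (congrArg Subtype.val hab), fun x => by
      obtain ⟨j, hj⟩ := (hσ _).1 x.2
      exact ⟨j, Subtype.ext hj⟩⟩
  have hcard : σ.card = d := by
    rw [← Fintype.card_coe, ← Fintype.card_congr E, Fintype.card_congr e, Fintype.card_fin]
  rw [absDet, dif_pos hcard, absDetFamily_congr e (E.trans (σ.equivFinOfCardEq hcard)),
    absDetFamily]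
  congr 3
  ext s t
  have : f (E.symm ((σ.equivFinOfCardEq hcard).symm s)) =
      ((σ.equivFinOfCardEq hcard).symm s : EuclideanSpace ℝ (Fin d)) :=
    congrArg Subtype.val (E.apply_symm_apply ((σ.equivFinOfCardEq hcard).symm s))
  simp [this]

theorem absDetFamily_smul {d : ℕ} {J : Type*} [Fintype J] (e : J ≃ Fin d) (c : J → ℝ)
    (hc : ∀ j, 0 < c j) (f : J → EuclideanSpace ℝ (Fin d)) :
    absDetFamily e (fun j => c j • f j) = (∏ j, c j) * absDetFamily e f := by
  have : (Matrix.of fun s t : Fin d => (c (e.symm s) • f (e.symm s)) t) =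
      Matrix.of fun s t : Fin d => c (e.symm s) *
        (Matrix.of fun s t : Fin d => f (e.symm s) t) s t := by
    ext s t
    simp
  rw [absDetFamily, this, Matrix.det_mul_column, abs_mul, absDetFamily,
    abs_of_nonneg (Finset.prod_nonneg fun s _ => (hc _).le), e.symm.prod_comp c]

theorem det_of_intCombination {d : ℕ} {J : Type*} [Fintype J] (e : J ≃ Fin d)
    {f g : J → EuclideanSpace ℝ (Fin d)} (B : J → J → ℤ)
    (hB : ∀ j, f j = ∑ k, (B j k : ℝ) • g k) :
    ∃ n : ℤ, (Matrix.of fun s t : Fin d => f (e.symm s) t).det =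
      n * (Matrix.of fun s t : Fin d => g (e.symm s) t).det := by
  refine ⟨(Matrix.of fun s t : Fin d => B (e.symm s) (e.symm t)).det, ?_⟩
  rw [Int.cast_det, ← Matrix.det_mul]
  congr 1
  ext s t
  rw [Matrix.of_apply, hB, Matrix.mul_apply, ← e.symm.sum_comp]
  simp

/-- Families of vectors that are integral combinations of each other have the same `|det|`. -/
theorem absDetFamily_eq_of_intCombination {d : ℕ} {J : Type*} [Fintype J] (e : J ≃ Fin d)
    {f g : J → EuclideanSpace ℝ (Fin d)} (B C : J → J → ℤ)
    (hB : ∀ j, f j = ∑ k, (B j k : ℝ) • g k) (hC : ∀ j, g j = ∑ k, (C j k : ℝ) • f k) :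
    absDetFamily e f = absDetFamily e g := by
  obtain ⟨n, hn⟩ := det_of_intCombination e B hB
  obtain ⟨k, hk⟩ := det_of_intCombination e C hC
  rw [absDetFamily, absDetFamily]
  by_cases h0 : (Matrix.of fun s t : Fin d => f (e.symm s) t).det = 0
  · rw [hk, h0, mul_zero]
  -- The two integer factors are inverse to each other, hence $\pm1$.
  · have h1 : ((n * k : ℤ) : ℝ) = 1 := by
      apply mul_right_cancel₀ h0
      rw [one_mul, Int.cast_mul, mul_assoc, ← hk, ← hn]
    have h2 : |n| = 1 := Int.isUnit_iff_abs_eq.1 (IsUnit.of_mul_eq_one k (by exact_mod_cast h1))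
    rw [hn, abs_mul, ← Int.cast_abs, h2, Int.cast_one, one_mul]

/-- The only ray of block `i` missing from the second family is minus the sum of the others in that
block. -/
theorem exists_intCombination_cellRays {d r : ℕ} {m : Fin r → ℕ}
    {v : ∀ i, Fin (m i + 1) → EuclideanSpace ℝ (Fin d)} (hv : ∀ i, ∑ b, v i b = 0)
    (a b : ∀ i, Fin (m i + 1)) : ∃ B : (Σ i, Fin (m i)) → (Σ i, Fin (m i)) → ℤ,
      ∀ x, cellRays v a x = ∑ y, (B x y : ℝ) • cellRays v b y := by
  have key : ∀ x, ∃ B : (Σ i, Fin (m i)) → ℤ,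
      cellRays v a x = ∑ y, (B y : ℝ) • cellRays v b y := by
    rintro ⟨i, j⟩
    rcases Fin.eq_self_or_eq_succAbove (b i) ((a i).succAbove j) with h | ⟨k, hk⟩
    · refine ⟨fun y => if y.1 = i then -1 else 0, ?_⟩
      rw [Fintype.sum_sigma, Finset.sum_eq_single i]
      · have := hv i
        rw [Fin.sum_univ_succAbove _ (b i)] at this
        simp only [cellRays, h]
        rw [eq_neg_of_add_eq_zero_left this]
        simp
      · intro k _ hk
        simp [hk]
      · exact fun hk => (hk (Finset.mem_univ i)).elim
    · refine ⟨fun y => if y = ⟨i, k⟩ then 1 else 0, ?_⟩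
      simp [cellRays, hk, ite_smul]
  choose B hB using key
  exact ⟨B, hB⟩

theorem absDetFamily_cellRays {d r : ℕ} {m : Fin r → ℕ}
    {v : ∀ i, Fin (m i + 1) → EuclideanSpace ℝ (Fin d)} (hv : ∀ i, ∑ b, v i b = 0)
    (e : (Σ i, Fin (m i)) ≃ Fin d) (a b : ∀ i, Fin (m i + 1)) :
    absDetFamily e (cellRays v a) = absDetFamily e (cellRays v b) := by
  obtain ⟨B, hB⟩ := exists_intCombination_cellRays hv a b
  obtain ⟨C, hC⟩ := exists_intCombination_cellRays hv b a
  exact absDetFamily_eq_of_intCombination e B C hB hC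

/-! ### The triangulations of the normal fan and the value of the fan -/

theorem rayOf_smul {d : ℕ} {w : EuclideanSpace ℝ (Fin d)} {s : ℝ} (hs : 0 < s) :
    rayOf (s • w) = rayOf w := by
  ext x
  constructor
  · rintro ⟨t, ht, rfl⟩
    exact ⟨t * s, mul_nonneg ht hs.le, smul_smul _ _ _⟩
  · rintro ⟨t, ht, rfl⟩
    exact ⟨t / s, div_nonneg ht hs.le, by rw [smul_smul, div_mul_cancel₀ _ hs.ne']⟩

theorem exists_smul_of_rayOf_eq {d : ℕ} {x w : EuclideanSpace ℝ (Fin d)} (hx : x ≠ 0)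
    (h : rayOf x = rayOf w) : ∃ s : ℝ, 0 < s ∧ x = s • w := by
  have hmem : x ∈ rayOf w := by
    rw [← h]; exact ⟨1, zero_le_one, (one_smul _ _).symm⟩
  obtain ⟨s, hs, rfl⟩ := hmem
  exact ⟨s, hs.lt_of_ne fun h0 => hx (by rw [← h0, zero_smul]), rfl⟩

theorem fanValue_eq {d : ℕ} {K : Type*} [Field K] [Algebra ℝ K]
    {N : Set (Set (EuclideanSpace ℝ (Fin d)))} {h : EuclideanSpace ℝ (Fin d) → K} {f : K}
    (hex : ∃ V T, IsTriangulation N V T)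
    (heq : ∀ V T, IsTriangulation N V T → triangulationSum T h = f) : fanValue N h = f := by
  have hf : ∃ f : K, (∃ V T, IsTriangulation N V T) ∧
      ∀ V T, IsTriangulation N V T → triangulationSum T h = f := ⟨f, hex, heq⟩
  rw [fanValue, dif_pos hf]
  obtain ⟨V, T, hT⟩ := hex
  rw [← hf.choose_spec.2 V T hT, heq V T hT]

namespace IsRaySystem

variable {d r : ℕ} {m : Fin r → ℕ} {p v : ∀ i, Fin (m i + 1) → EuclideanSpace ℝ (Fin d)}

theorem exists_minCone_eq (h : IsRaySystem p v) (a : ∀ i, Fin (m i + 1)) :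
    ∃ u, minCone p u = {w | ∀ i, IsMinAt (p i) w (a i)} := by
  obtain ⟨u, hu⟩ := h.exists_isMinAt_iff a
  refine ⟨u, Set.ext fun w => ⟨fun hw i => hw i _ ((hu i _).2 rfl), fun hw i b hb => ?_⟩⟩
  rw [(hu i b).1 hb]
  exact hw i

-- Blocks with `m i = 0` are left out since their only vector is zero; by `smul_ray_eq` the
-- remaining vectors span different rays.
open Classical in
theorem isRayGenerators (h : IsRaySystem p v) :
    IsRayGenerators (normalFan (∑ i, convexHull ℝ (Set.range (p i))))
      ((Finset.univ.filter fun x : Σ i, Fin (m i + 1) => 0 < m x.1).image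
        fun x => v x.1 x.2) := by
  constructor
  · intro x hx
    simp only [Finset.mem_image, Finset.mem_filter, Finset.mem_univ, true_and] at hx
    obtain ⟨⟨i, a⟩, hi, rfl⟩ := hx
    exact h.generatesRay_iff.2 ⟨i, a, 1, hi, one_pos, (one_smul _ _).symm⟩
  · intro w hw
    obtain ⟨i, a, s, hi, hs, rfl⟩ := h.generatesRay_iff.1 hw
    refine ⟨v i a, ⟨?_, (rayOf_smul hs).symm⟩, ?_⟩
    · simp only [Finset.mem_image, Finset.mem_filter, Finset.mem_univ, true_and]
      exact ⟨⟨i, a⟩, hi, rfl⟩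
    · rintro x ⟨hx, hray⟩
      simp only [Finset.mem_image, Finset.mem_filter, Finset.mem_univ, true_and] at hx
      obtain ⟨⟨k, b⟩, hk, rfl⟩ := hx
      rw [rayOf_smul hs] at hray
      obtain ⟨t, ht, heq⟩ := exists_smul_of_rayOf_eq (h.ray_ne_zero hk b) hray
      have := h.smul_ray_eq hk one_pos ht (by rwa [one_smul])
      cases this
      rfl

open Classical in
/-- The normal fan of a transversal sum of simplices is simplicial. -/
theorem isTriangulation (h : IsRaySystem p v) :
    IsTriangulation (normalFan (∑ i, convexHull ℝ (Set.range (p i))))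
      ((Finset.univ.filter fun x : Σ i, Fin (m i + 1) => 0 < m x.1).image fun x => v x.1 x.2)
      (Finset.univ.image (cellSet fun i b => (1 : ℝ) • v i b)) := by
  have ht : ∀ i, Fin (m i + 1) → (0 : ℝ) < 1 := fun _ _ => one_pos
  have hcone : ∀ (a : ∀ i, Fin (m i + 1)), coneOf (cellSet (fun i b => (1 : ℝ) • v i b) a) =
      {w | ∀ i, IsMinAt (p i) w (a i)} :=
    fun a => Set.ext fun w => h.mem_coneOf_cellSet_iff ht
  have href : ∀ a, coneOf (cellSet (fun i b => (1 : ℝ) • v i b) a) ∈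
      normalFan (∑ i, convexHull ℝ (Set.range (p i))) := by
    intro a
    obtain ⟨u, hu⟩ := h.exists_minCone_eq a
    rw [hcone, ← hu]
    exact (mem_normalFan_iff p _).2 ⟨u, rfl⟩
  refine ⟨h.isRayGenerators, ?_, ?_, ?_, ?_, ?_, ?_⟩
  · simp only [Finset.mem_image, Finset.mem_univ, true_and, forall_exists_index,
      forall_apply_eq_imp_iff]
    intro a x hx
    simp only [cellSet, Finset.mem_image, Finset.mem_univ, true_and] at hx
    obtain ⟨⟨i, j⟩, rfl⟩ := hx
    simp only [Finset.mem_image, Finset.mem_filter, Finset.mem_univ, true_and]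
    exact ⟨⟨i, (a i).succAbove j⟩, j.pos, by simp [cellRays]⟩
  · simp only [Finset.mem_image, Finset.mem_univ, true_and, forall_exists_index,
      forall_apply_eq_imp_iff]
    exact fun a => h.card_cellSet ht a
  · simp only [Finset.mem_image, Finset.mem_univ, true_and, forall_exists_index,
      forall_apply_eq_imp_iff]
    intro a
    have := (h.linearIndependent_cellRays ht a).linearIndepOn_id
    have hset : Set.range (cellRays (fun i b => (1 : ℝ) • v i b) a) =
        (cellSet (fun i b => (1 : ℝ) • v i b) a : Set (EuclideanSpace ℝ (Fin d))) := by
      simp [cellSet]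
    rw [hset] at this
    exact this
  · simp only [Finset.mem_image, Finset.mem_univ, true_and, forall_exists_index,
      forall_apply_eq_imp_iff]
    exact fun a => ⟨_, href a, subset_rfl⟩
  · refine Set.Subset.antisymm (Set.iUnion₂_subset fun σ hσ => ?_) fun w _ => ?_
    · simp only [Finset.mem_image, Finset.mem_univ, true_and] at hσ
      obtain ⟨a, rfl⟩ := hσ
      exact Set.subset_sUnion_of_mem (href a)
    · choose a ha using fun i => exists_isMinAt (p i) w
      exact Set.mem_iUnion₂.2 ⟨_, Finset.mem_image_of_mem _ (Finset.mem_univ a),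
        (h.mem_coneOf_cellSet_iff ht).2 ha⟩
  · simp only [Finset.mem_image, Finset.mem_univ, true_and, forall_exists_index,
      forall_apply_eq_imp_iff]
    intro a b
    rw [hcone, hcone]
    have hinner : ∀ x, (inner ℝ x (∑ i, (p i (a i) - p i (b i))) : ℝ) =
        ∑ i, ((inner ℝ x (p i (a i)) : ℝ) - inner ℝ x (p i (b i))) := by
      intro x
      simp only [inner_sum, inner_sub_right]
    -- On the cone of `a` each summand of this functional is at most 0, and the sum vanishes
    -- precisely where the vertices `b i` are minimal as well.
    refine ⟨⟨0, fun i c => by simp, fun i c => by simp⟩, Set.inter_subset_left,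
      ∑ i, (p i (a i) - p i (b i)), 0, ?_, ?_⟩
    · rintro x ⟨hxa, hxb⟩
      rw [hinner]
      exact Finset.sum_eq_zero fun i _ => by rw [sub_eq_zero, le_antisymm (hxa i _) (hxb i _)]
    · rintro x ⟨hxa, hx⟩
      rw [hinner]
      have hle : ∀ i ∈ Finset.univ, (inner ℝ x (p i (a i)) : ℝ) - inner ℝ x (p i (b i)) ≤ 0 :=
        fun i _ => sub_nonpos.2 (hxa i _)
      refine lt_of_le_of_ne (Finset.sum_nonpos hle) fun h0 => hx ⟨hxa, fun i c => ?_⟩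
      have := (Finset.sum_eq_zero_iff_of_nonpos hle).1 h0 i (Finset.mem_univ i)
      rw [← sub_eq_zero.1 this]
      exact hxa i c

open Classical in
/-- The triangulation of the normal fan is unique up to the choice of the generators. -/
theorem exists_eq_image_of_isTriangulation (h : IsRaySystem p v)
    {V : Finset (EuclideanSpace ℝ (Fin d))} {T : Finset (Finset (EuclideanSpace ℝ (Fin d)))}
    (hT : IsTriangulation (normalFan (∑ i, convexHull ℝ (Set.range (p i)))) V T) :
    ∃ t : ∀ i, Fin (m i + 1) → ℝ, (∀ i a, 0 < t i a) ∧
      T = Finset.univ.image (cellSet fun i b => t i b • v i b) := by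
  have hex : ∀ i (a : Fin (m i + 1)), ∃ t : ℝ, 0 < t ∧ (0 < m i → t • v i a ∈ V) := by
    intro i a
    by_cases hi : 0 < m i
    · obtain ⟨x, ⟨hxV, hx⟩, -⟩ := hT.generators.2 (v i a)
        (h.generatesRay_iff.2 ⟨i, a, 1, hi, one_pos, (one_smul _ _).symm⟩)
      obtain ⟨s, hs, rfl⟩ := exists_smul_of_rayOf_eq (hT.generators.1 x hxV).1 hx
      exact ⟨s, hs, fun _ => hxV⟩
    · exact ⟨1, one_pos, fun h => (hi h).elim⟩
  choose t ht htV using hex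
  refine ⟨t, ht, ?_⟩
  have hV : ∀ x ∈ V, ∃ (i : Fin r) (a : Fin (m i + 1)), 0 < m i ∧ x = t i a • v i a := by
    intro x hx
    obtain ⟨i, a, s, hi, hs, rfl⟩ := h.generatesRay_iff.1 (hT.generators.1 x hx)
    refine ⟨i, a, hi, ?_⟩
    obtain ⟨y, -, hy⟩ := hT.generators.2 (v i a)
      (h.generatesRay_iff.2 ⟨i, a, 1, hi, one_pos, (one_smul _ _).symm⟩)
    rw [hy _ ⟨hx, rayOf_smul hs⟩, hy _ ⟨htV i a hi, rayOf_smul (ht i a)⟩]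
  have hsub : ∀ σ ∈ T, ∃ a, σ = cellSet (fun i b => t i b • v i b) a := by
    intro σ hσ
    obtain ⟨C, hC, hσC⟩ := hT.refines σ hσ
    obtain ⟨u, rfl⟩ := (mem_normalFan_iff p C).1 hC
    -- The vector $v_{i,a_i}$ is not minimal at the vertex `a i`, so no multiple of it occurs in
    -- `σ`. Thus `σ` lies in the cell of `a`, and both have `d` elements.
    choose a ha using fun i => exists_isMinAt (p i) u
    refine ⟨a, Finset.eq_of_subset_of_card_le (fun x hx => ?_) ?_⟩
    · have hmin := hσC (Submodule.subset_span hx)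
      obtain ⟨i, b, hi, rfl⟩ := hV x (hT.subset σ hσ hx)
      have hb : b ≠ a i := by
        rintro rfl
        exact h.not_isMinAt_ray hi _ ((isMinAt_smul_iff (ht _ _)).1 (hmin i _ (ha i)))
      obtain ⟨j, rfl⟩ := Fin.exists_succAbove_eq hb
      exact Finset.mem_image_of_mem _ (Finset.mem_univ (⟨i, j⟩ : Σ i, Fin (m i)))
    · rw [hT.card_eq σ hσ, h.card_cellSet ht]
  ext σ
  simp only [Finset.mem_image, Finset.mem_univ, true_and]
  constructor
  · intro hσ
    obtain ⟨a, rfl⟩ := hsub σ hσ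
    exact ⟨a, rfl⟩
  · rintro ⟨a, rfl⟩
    -- A vector minimal only at the vertices `a i` is covered by some cone of `T`, which can only be
    -- that of `a`.
    obtain ⟨w, hw⟩ := h.exists_isMinAt_iff a
    have hwN : w ∈ ⋃₀ normalFan (∑ i, convexHull ℝ (Set.range (p i))) :=
      Set.mem_sUnion.2 ⟨minCone p w, (mem_normalFan_iff p _).2 ⟨w, rfl⟩, fun i b hb => hb⟩
    rw [← hT.covers] at hwN
    obtain ⟨σ, hσ, hwσ⟩ := Set.mem_iUnion₂.1 hwN
    obtain ⟨b, rfl⟩ := hsub σ hσ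
    have hba : b = a :=
      funext fun i => (hw i _).1 ((h.mem_coneOf_cellSet_iff ht).1 hwσ i)
    rwa [← hba]

theorem absDet_cellSet (h : IsRaySystem p v) {t : ∀ i, Fin (m i + 1) → ℝ}
    (ht : ∀ i a, 0 < t i a) (e : (Σ i, Fin (m i)) ≃ Fin d) (a : ∀ i, Fin (m i + 1)) :
    absDet (cellSet (fun i b => t i b • v i b) a) =
      (∏ x : Σ i, Fin (m i), t x.1 ((a x.1).succAbove x.2)) * absDetFamily e (cellRays v a) := by
  rw [absDet_image e (h.linearIndependent_cellRays ht a).injective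
    (fun x => by simp [cellSet]), ← absDetFamily_smul e _ (fun x => ht _ _)]
  rfl

/-- The term of the maximal cone of the vertex `∑ i, p i (a i)`. -/
theorem absDet_div_prod (h : IsRaySystem p v) {t : ∀ i, Fin (m i + 1) → ℝ}
    (ht : ∀ i a, 0 < t i a) (e : (Σ i, Fin (m i)) ≃ Fin d) (a : ∀ i, Fin (m i + 1))
    {K : Type*} [Field K] [Algebra ℝ K] {u : EuclideanSpace ℝ (Fin d) → K}
    (hu : ∀ s : ℝ, 0 < s → ∀ w, u (s • w) = algebraMap ℝ K s * u w) :
    algebraMap ℝ K (absDet (cellSet (fun i b => t i b • v i b) a)) /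
        ∏ x ∈ cellSet (fun i b => t i b • v i b) a, u x =
      algebraMap ℝ K (absDetFamily e (cellRays v a)) *
        ∏ i, ∏ j, (u (v i ((a i).succAbove j)))⁻¹ := by
  have hprod : ∏ x ∈ cellSet (fun i b => t i b • v i b) a, u x =
      algebraMap ℝ K (∏ x : Σ i, Fin (m i), t x.1 ((a x.1).succAbove x.2)) *
        ∏ i, ∏ j, u (v i ((a i).succAbove j)) := by
    rw [cellSet, Finset.prod_image ((h.linearIndependent_cellRays ht a).injective.injOn),
      map_prod, ← Fintype.prod_sigma' (fun i j => u (v i ((a i).succAbove j))),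
      ← Finset.prod_mul_distrib]
    exact Finset.prod_congr rfl fun x _ => hu _ (ht _ _) _
  -- The product of the scales occurs both in the determinant and in the denominator, and cancels.
  have hne : algebraMap ℝ K (∏ x : Σ i, Fin (m i), t x.1 ((a x.1).succAbove x.2)) ≠ 0 :=
    (map_ne_zero _).2 (Finset.prod_ne_zero_iff.2 fun x _ => (ht _ _).ne')
  rw [hprod, h.absDet_cellSet ht e, map_mul, mul_div_mul_left _ _ hne, div_eq_mul_inv]
  simp only [Finset.prod_inv_distrib]

/-- Over the common denominator `∏ a, f a`, the numerator of each term is the one omitted factor. -/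
theorem sum_prod_inv_succAbove {K : Type*} [Field K] {n : ℕ} (f : Fin (n + 1) → K)
    (hf : ∀ a, f a ≠ 0) :
    ∑ a : Fin (n + 1), ∏ j, (f (a.succAbove j))⁻¹ = (∑ a, f a) / ∏ a, f a := by
  rw [Finset.sum_div]
  refine Finset.sum_congr rfl fun a _ => ?_
  rw [Fin.prod_univ_succAbove f a, Finset.prod_inv_distrib, div_mul_eq_div_div, div_self (hf a),
    one_div]

/-- The rational function of the normal fan of a transversal sum of simplices. -/
theorem fanValue_normalFan (h : IsRaySystem p v) (e : (Σ i, Fin (m i)) ≃ Fin d)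
    (a₀ : ∀ i, Fin (m i + 1)) {K : Type*} [Field K] [Algebra ℝ K]
    {u : EuclideanSpace ℝ (Fin d) → K}
    (hu : ∀ s : ℝ, 0 < s → ∀ w, u (s • w) = algebraMap ℝ K s * u w)
    (hne : ∀ i, 0 < m i → ∀ a, u (v i a) ≠ 0) :
    fanValue (normalFan (∑ i, convexHull ℝ (Set.range (p i)))) u =
      algebraMap ℝ K (absDetFamily e (cellRays v a₀)) *
        ((∏ i with 0 < m i, ∑ a, u (v i a)) / ∏ i with 0 < m i, ∏ a, u (v i a)) := by
  classical
  refine fanValue_eq ⟨_, _, h.isTriangulation⟩ fun V T hT => ?_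
  obtain ⟨t, ht, rfl⟩ := h.exists_eq_image_of_isTriangulation hT
  rw [triangulationSum, Finset.sum_image (h.cellSet_injective ht).injOn]
  simp only [h.absDet_div_prod ht e _ hu, absDetFamily_cellRays h.sum_ray e _ a₀]
  -- With the determinant constant, the sum over all tuples of vertices is an expanded product over
  -- the simplices.
  rw [← Finset.mul_sum,
    ← Fintype.prod_sum fun i (a : Fin (m i + 1)) => ∏ j, (u (v i (a.succAbove j)))⁻¹,
    ← Finset.prod_div_distrib, Finset.prod_filter]
  congr 1
  refine Finset.prod_congr rfl fun i _ => ?_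
  split_ifs with hi
  · exact sum_prod_inv_succAbove _ (hne i hi)
  -- A point contributes a single empty product, hence the factor 1.
  · have h0 : m i = 0 := by omega
    have : IsEmpty (Fin (m i)) := by rw [h0]; infer_instance
    simp [h0]

end IsRaySystem

/-! ### Facets -/

theorem vectorSpan_convexHull {d : ℕ} (S : Set (EuclideanSpace ℝ (Fin d))) :
    vectorSpan ℝ (convexHull ℝ S) = vectorSpan ℝ S := by
  rw [← direction_affineSpan, affineSpan_convexHull, direction_affineSpan]

theorem dim_convexHull_range {d n : ℕ} {p : Fin (n + 1) → EuclideanSpace ℝ (Fin d)}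
    (hp : AffineIndependent ℝ p) : dim (convexHull ℝ (Set.range p)) = n := by
  rw [dim, vectorSpan_convexHull]
  exact hp.finrank_vectorSpan (by simp)

theorem inner_vectorSpan_argmin {d : ℕ} {S : Set (EuclideanSpace ℝ (Fin d))}
    {w x : EuclideanSpace ℝ (Fin d)} (hx : x ∈ vectorSpan ℝ (argmin S w)) :
    (inner ℝ w x : ℝ) = 0 := by
  have hle : vectorSpan ℝ (argmin S w) ≤ (ℝ ∙ w)ᗮ := by
    rw [vectorSpan, Submodule.span_le]
    rintro _ ⟨y, hy, z, hz, rfl⟩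
    rw [SetLike.mem_coe, Submodule.mem_orthogonal_singleton_iff_inner_right]
    simp only [vsub_eq_sub, inner_sub_right]
    rw [le_antisymm (hy.2 z hz.1) (hz.2 y hy.1), sub_self]
  exact Submodule.mem_orthogonal_singleton_iff_inner_right.1 (hle hx)

/-- The hyperplane orthogonal to `w` contains `W` but not `q`, so it cuts `W + ℝq` exactly in `W`.
This and the dimension count that follows are used with `W` the directions of a facet and `q` an
edge leaving it. -/
theorem mem_of_le_sup_span_singleton {d : ℕ} {W U : Submodule ℝ (EuclideanSpace ℝ (Fin d))}
    {w q x : EuclideanSpace ℝ (Fin d)} (hw : ∀ x ∈ W, (inner ℝ w x : ℝ) = 0)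
    (hU : U ≤ W ⊔ (ℝ ∙ q)) (hq : (inner ℝ w q : ℝ) ≠ 0) (hx : x ∈ U)
    (hwx : (inner ℝ w x : ℝ) = 0) : x ∈ W := by
  obtain ⟨y, hy, z, hz, rfl⟩ := Submodule.mem_sup.1 (hU hx)
  obtain ⟨c, rfl⟩ := Submodule.mem_span_singleton.1 hz
  rw [inner_add_right, hw y hy, zero_add, real_inner_smul_right] at hwx
  rw [(mul_eq_zero.1 hwx).resolve_right hq, zero_smul, add_zero]
  exact hy

theorem finrank_add_one_of_sup_span_singleton {d : ℕ}
    {W U : Submodule ℝ (EuclideanSpace ℝ (Fin d))}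
    {w q : EuclideanSpace ℝ (Fin d)} (hw : ∀ x ∈ W, (inner ℝ w x : ℝ) = 0) (hWU : W ≤ U)
    (hU : U ≤ W ⊔ (ℝ ∙ q)) (hqU : q ∈ U) (hq : (inner ℝ w q : ℝ) ≠ 0) :
    Module.finrank ℝ W + 1 = Module.finrank ℝ U := by
  have hq0 : q ≠ 0 := by
    rintro rfl
    exact hq (inner_zero_right _)
  have hsup : W ⊔ (ℝ ∙ q) = U :=
    le_antisymm (sup_le hWU ((Submodule.span_singleton_le_iff_mem _ _).2 hqU)) hU
  have hinf : W ⊓ (ℝ ∙ q) = ⊥ := by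
    rw [eq_bot_iff]
    rintro x ⟨hx, hxq⟩
    obtain ⟨c, rfl⟩ := Submodule.mem_span_singleton.1 hxq
    have := hw _ hx
    rw [real_inner_smul_right] at this
    simp [(mul_eq_zero.1 this).resolve_right hq]
  have := Submodule.finrank_sup_add_finrank_inf_eq W (ℝ ∙ q)
  rw [hsup, hinf, finrank_bot, finrank_span_singleton hq0] at this
  omega

theorem width_eq_supportFn {d : ℕ} (S : Set (EuclideanSpace ℝ (Fin d)))
    (w : EuclideanSpace ℝ (Fin d)) :
    sSup ((fun y => (inner ℝ y w : ℝ)) '' S) - sInf ((fun y => (inner ℝ y w : ℝ)) '' S) =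
      supportFn S (-w) + supportFn S w := by
  have h : (fun y => (inner ℝ (-w) y : ℝ)) '' S = -((fun y => (inner ℝ y w : ℝ)) '' S) := by
    rw [← Set.image_neg_eq_neg, Set.image_image]
    simp only [inner_neg_left, real_inner_comm]
  rw [supportFn, supportFn, h, Real.sInf_def (-_), neg_neg, neg_neg, sub_eq_add_neg]
  simp only [real_inner_comm]

theorem argmin_eq_of_isMinAt_iff {d n : ℕ} {p : Fin (n + 1) → EuclideanSpace ℝ (Fin d)}
    {u w : EuclideanSpace ℝ (Fin d)} (h : ∀ a, IsMinAt p u a ↔ IsMinAt p w a) :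
    argmin (convexHull ℝ (Set.range p)) u = argmin (convexHull ℝ (Set.range p)) w := by
  have key : ∀ u w, (∀ a, IsMinAt p u a ↔ IsMinAt p w a) →
      argmin (convexHull ℝ (Set.range p)) u ⊆ argmin (convexHull ℝ (Set.range p)) w := by
    intro u w h x hx
    obtain ⟨c, h0, h1, rfl, hc⟩ := exists_combination_of_mem_argmin hx
    exact mem_argmin_of_combination h0 h1 fun a ha => hc a fun hu => ha ((h a).1 hu)
  exact (key u w h).antisymm (key w u fun a => (h a).symm)

/-- A facet of a simplex contains all vertices but one. -/
theorem exists_vertex_of_isFacet {d n : ℕ} {p : Fin (n + 1) → EuclideanSpace ℝ (Fin d)}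
    (hp : AffineIndependent ℝ p) {u : EuclideanSpace ℝ (Fin d)}
    (hF : IsFacet (convexHull ℝ (Set.range p)) (argmin (convexHull ℝ (Set.range p)) u)) :
    ∃ a, ∀ b, IsMinAt p u b ↔ b ≠ a := by
  classical
  have hdim := hF.2
  rw [dim_convexHull_range hp] at hdim
  -- The face lies in the hull of its minimising vertices `s`, so dimension `n - 1` needs at least
  -- `n` of them; having all `n + 1` would make the face the whole simplex.
  set s : Finset (Fin (n + 1)) := Finset.univ.filter fun b => IsMinAt p u b with hs
  have hsub : argmin (convexHull ℝ (Set.range p)) u ⊆ convexHull ℝ (s.image p : Set _) := by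
    intro x hx
    obtain ⟨c, h0, h1, rfl, hc⟩ := exists_combination_of_mem_argmin hx
    have hz : ∀ b ∈ Finset.univ, b ∉ s → c b = 0 := fun b _ hb => hc b fun h => hb (by simp [hs, h])
    rw [← Finset.sum_subset (Finset.subset_univ s) fun b hb hbs => by rw [hz b hb hbs, zero_smul]]
    refine (convex_convexHull ℝ _).sum_mem (fun b _ => h0 b) ?_ fun b hb =>
      subset_convexHull _ _ (Finset.mem_coe.2 (Finset.mem_image_of_mem p hb))
    rw [Finset.sum_subset (Finset.subset_univ s) hz, h1]
  obtain ⟨a₀, ha₀⟩ := exists_isMinAt p u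
  have hpos : 0 < s.card := Finset.card_pos.2 ⟨a₀, by simp [hs, ha₀]⟩
  have hrank : dim (argmin (convexHull ℝ (Set.range p)) u) ≤ s.card - 1 := by
    refine (Submodule.finrank_mono (vectorSpan_mono ℝ hsub)).trans ?_
    rw [vectorSpan_convexHull, Finset.coe_image, ← Finset.coe_image]
    exact finrank_vectorSpan_image_finset_le ℝ p s (by omega)
  have hne : s ≠ Finset.univ := by
    intro h
    have hall : ∀ b, IsMinAt p u b := fun b => by
      have : b ∈ s := by rw [h]; exact Finset.mem_univ b
      simpa [hs] using this
    have : argmin (convexHull ℝ (Set.range p)) u = convexHull ℝ (Set.range p) := by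
      refine Set.Subset.antisymm (fun x hx => hx.1) fun x hx => ?_
      obtain ⟨c, h0, h1, rfl⟩ := mem_convexHull_range_iff.1 hx
      exact mem_argmin_of_combination h0 h1 fun a ha => (ha (hall a)).elim
    rw [this, dim_convexHull_range hp] at hdim
    omega
  have hlt : s.card < n + 1 := by
    simpa using Finset.card_lt_univ_of_notMem
      (Classical.choose_spec (not_forall.1 fun h => hne (Finset.eq_univ_iff_forall.2 h)))
  have hcompl : sᶜ.card = 1 := by
    rw [Finset.card_compl, Fintype.card_fin]
    omega
  obtain ⟨a, ha⟩ := Finset.card_eq_one.1 hcompl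
  refine ⟨a, fun b => ?_⟩
  have : b ∈ sᶜ ↔ b = a := by rw [ha, Finset.mem_singleton]
  rw [Finset.mem_compl, not_iff_comm] at this
  rw [ne_eq, this]
  simp [hs]

/-! ### Normalised normal rays -/

/-- A vector constant on each summand is constant on the Minkowski sum, hence orthogonal to the
directions of a full-dimensional set. -/
theorem eq_zero_of_inner_eq {d r : ℕ} {m : Fin r → ℕ}
    {p : ∀ i, Fin (m i + 1) → EuclideanSpace ℝ (Fin d)}
    (hdim : dim (∑ i, convexHull ℝ (Set.range (p i))) = d) (w : EuclideanSpace ℝ (Fin d))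
    (hw : ∀ k b c, (inner ℝ w (p k b) : ℝ) = inner ℝ w (p k c)) : w = 0 := by
  have hmin : ∑ i, convexHull ℝ (Set.range (p i)) ⊆
      argmin (∑ i, convexHull ℝ (Set.range (p i))) w := by
    intro x hx
    obtain ⟨g, hg, rfl⟩ := (Set.mem_fintype_sum _ _).1 hx
    refine (sum_mem_argmin_iff hg).2 fun i => ?_
    obtain ⟨c, h0, h1, hgi⟩ := mem_convexHull_range_iff.1 (hg i)
    rw [← hgi]
    exact mem_argmin_of_combination h0 h1 fun a ha => (ha fun b => (hw i a b).le).elim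
  have htop : vectorSpan ℝ (∑ i, convexHull ℝ (Set.range (p i))) = ⊤ :=
    Submodule.eq_top_of_finrank_eq (by rw [finrank_euclideanSpace_fin]; exact hdim)
  have hmem : w ∈ vectorSpan ℝ (∑ i, convexHull ℝ (Set.range (p i))) := by rw [htop]; trivial
  exact inner_self_eq_zero.1 (inner_vectorSpan_argmin (vectorSpan_mono ℝ hmin hmem))

theorem sum_update_sub_sum_update {d r : ℕ} {m : Fin r → ℕ}
    (p : ∀ i, Fin (m i + 1) → EuclideanSpace ℝ (Fin d)) (β : ∀ i, Fin (m i + 1)) (k : Fin r)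
    (c c' : Fin (m k + 1)) : ∑ l, p l (Function.update β k c l) -
      ∑ l, p l (Function.update β k c' l) = p k c - p k c' := by
  rw [← Finset.sum_sub_distrib, Finset.sum_eq_single k]
  · simp
  · intro l _ hl
    simp [hl]
  · exact fun hk => (hk (Finset.mem_univ k)).elim

/-- Existence of the rays, by duality. -/
theorem exists_isRaySystem {d r : ℕ} {m : Fin r → ℕ}
    {p : ∀ i, Fin (m i + 1) → EuclideanSpace ℝ (Fin d)} (hm : ∑ i, m i = d)
    (hp : ∀ w, (∀ k b c, (inner ℝ w (p k b) : ℝ) = inner ℝ w (p k c)) → w = 0) :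
    ∃ v, IsRaySystem p v := by
  classical
  -- `Φ` evaluates a vector on the edges leaving vertex 0 of each simplex. It is injective by `hp`,
  -- and both sides have dimension `d`, so every prescription of edge values is realised.
  let Φ : EuclideanSpace ℝ (Fin d) →ₗ[ℝ] ((Σ i, Fin (m i)) → ℝ) :=
    { toFun := fun w x => inner ℝ w (p x.1 x.2.succ - p x.1 0)
      map_add' := fun w w' => funext fun x => inner_add_left _ _ _
      map_smul' := fun c w => funext fun x => real_inner_smul_left _ _ _ }
  have hinj : Function.Injective Φ := by
    rw [← LinearMap.ker_eq_bot, LinearMap.ker_eq_bot']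
    intro w hw
    have h0 : ∀ k b, (inner ℝ w (p k b) : ℝ) = inner ℝ w (p k 0) := by
      intro k b
      refine Fin.cases rfl (fun j => ?_) b
      have : (inner ℝ w (p k j.succ - p k 0) : ℝ) = 0 := congrFun hw ⟨k, j⟩
      rwa [inner_sub_right, sub_eq_zero] at this
    exact hp w fun k b c => (h0 k b).trans (h0 k c).symm
  have hsurj : Function.Surjective Φ :=
    (LinearMap.injective_iff_surjective_of_finrank_eq_finrank (by
      rw [finrank_euclideanSpace_fin, Module.finrank_fintype_fun_eq_card]
      simp [hm])).1 hinj
  let δ : (Σ i, Fin (m i + 1)) → (Σ i, Fin (m i + 1)) → ℝ := fun x y => if y = x then 1 else 0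
  choose v hv using fun x : Σ i, Fin (m i + 1) =>
    hsurj fun y => δ x ⟨y.1, y.2.succ⟩ - δ x ⟨y.1, 0⟩
  have hv0 : ∀ x k b, (inner ℝ (v x) (p k b) : ℝ) - inner ℝ (v x) (p k 0) =
      δ x ⟨k, b⟩ - δ x ⟨k, 0⟩ := by
    intro x k b
    refine Fin.cases (by simp) (fun j => ?_) b
    rw [← inner_sub_right]
    exact congrFun (hv x) ⟨k, j⟩
  have hv1 : ∀ x k b c, (inner ℝ (v x) (p k b) : ℝ) - inner ℝ (v x) (p k c) =
      δ x ⟨k, b⟩ - δ x ⟨k, c⟩ := by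
    intro x k b c
    linarith [hv0 x k b, hv0 x k c]
  refine ⟨fun i a => v ⟨i, a⟩, ⟨fun i a k hk b c => ?_, fun i a b c => ?_, hp, hm⟩⟩
  · rw [← sub_eq_zero, hv1]
    simp [δ, hk]
  · rw [hv1]
    simp [δ]

namespace IsRaySystem

variable {d r : ℕ} {m : Fin r → ℕ} {p v : ∀ i, Fin (m i + 1) → EuclideanSpace ℝ (Fin d)}

/-- The face contains all vertices but `a`; one edge ending at `a` supplies the missing direction.
-/
theorem isFacet_argmin_ray (h : IsRaySystem p v) {i : Fin r} (hi : 0 < m i) (a : Fin (m i + 1)) :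
    IsFacet (convexHull ℝ (Set.range (p i))) (argmin (convexHull ℝ (Set.range (p i))) (v i a)) := by
  have : Nontrivial (Fin (m i + 1)) := Fin.nontrivial_iff_two_le.2 (by omega)
  obtain ⟨b, hb⟩ := exists_ne a
  refine ⟨isFace_argmin (argmin_nonempty _ _), ?_⟩
  have hq := h.inner_self i a a b
  rw [if_pos rfl, if_neg hb, sub_zero, ← inner_sub_right] at hq
  refine finrank_add_one_of_sup_span_singleton (w := v i a) (q := p i a - p i b)
    (fun x hx => inner_vectorSpan_argmin hx) (vectorSpan_mono ℝ fun x hx => hx.1) ?_ ?_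
    (by rw [hq]; exact one_ne_zero)
  · rw [vectorSpan_convexHull, vectorSpan_range_eq_span_range_vsub_right ℝ (p i) b,
      Submodule.span_le]
    rintro _ ⟨c, rfl⟩
    by_cases hc : c = a
    · subst hc
      exact Submodule.mem_sup_right (Submodule.mem_span_singleton_self _)
    · exact Submodule.mem_sup_left (vsub_mem_vectorSpan ℝ
        (mem_argmin_convexHull_iff.2 (h.isMinAt_ray_of_ne' hc))
        (mem_argmin_convexHull_iff.2 (h.isMinAt_ray_of_ne' hb)))
  · rw [vectorSpan_convexHull]
    exact vsub_mem_vectorSpan ℝ (Set.mem_range_self a) (Set.mem_range_self b)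

theorem width_eq_one (h : IsRaySystem p v) {i : Fin r} (hi : 0 < m i) (a : Fin (m i + 1)) :
    supportFn (convexHull ℝ (Set.range (p i))) (-v i a) +
      supportFn (convexHull ℝ (Set.range (p i))) (v i a) = 1 := by
  have : Nontrivial (Fin (m i + 1)) := Fin.nontrivial_iff_two_le.2 (by omega)
  obtain ⟨b, hb⟩ := exists_ne a
  have ha : IsMinAt (p i) (-v i a) a := by
    intro c
    have := h.inner_self i a a c
    rw [if_pos rfl] at this
    rw [inner_neg_left, inner_neg_left]
    split_ifs at this <;> linarith
  rw [supportFn_eq_of_mem_argmin (mem_argmin_convexHull_iff.2 ha),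
    supportFn_eq_of_mem_argmin (mem_argmin_convexHull_iff.2 (h.isMinAt_ray_of_ne' hb)),
    inner_neg_left]
  have := h.inner_self i a a b
  rw [if_pos rfl, if_neg hb] at this
  linarith

/-! ### Support functions at the rays -/

theorem supportFn_ray_ne (h : IsRaySystem p v) {i k : Fin r} (hk : k ≠ i) (a : Fin (m i + 1)) :
    supportFn (convexHull ℝ (Set.range (p k))) (v i a) = -inner ℝ (v i a) (p k 0) :=
  supportFn_eq_of_mem_argmin (mem_argmin_convexHull_iff.2 (h.isMinAt_ray_of_ne hk a 0))

/-- The same base vertex 0 is used for all rays so that the inner products cancel on summation. It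
minimises $v_{i,a}$ unless `a = 0`, when it lies 1 above the minimum. -/
theorem supportFn_ray_self (h : IsRaySystem p v) {i : Fin r} (hi : 0 < m i) (a : Fin (m i + 1)) :
    supportFn (convexHull ℝ (Set.range (p i))) (v i a) =
      -inner ℝ (v i a) (p i 0) + if a = 0 then 1 else 0 := by
  have : Nontrivial (Fin (m i + 1)) := Fin.nontrivial_iff_two_le.2 (by omega)
  obtain ⟨b, hb⟩ := exists_ne a
  rw [supportFn_eq_of_mem_argmin (mem_argmin_convexHull_iff.2 (h.isMinAt_ray_of_ne' hb))]
  have := h.inner_self i a 0 b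
  rw [if_neg hb] at this
  simp only [eq_comm (a := a)]
  linarith

/-- The source of the numerator $x_i$: the base terms cancel as the rays of a block sum to zero, and
only the correction at `a = 0` survives. -/
theorem sum_supportFn_ray (h : IsRaySystem p v) {i : Fin r} (hi : 0 < m i) (k : Fin r) :
    ∑ a, supportFn (convexHull ℝ (Set.range (p k))) (v i a) = if k = i then 1 else 0 := by
  have hsum : ∀ x, ∑ a, -(inner ℝ (v i a) x : ℝ) = 0 := fun x => by
    rw [Finset.sum_neg_distrib, ← sum_inner, h.sum_ray, inner_zero_left, neg_zero]
  split_ifs with hk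
  · subst hk
    simp only [h.supportFn_ray_self hi, Finset.sum_add_distrib, hsum]
    simp
  · simp only [h.supportFn_ray_ne hk, hsum]

/-- A vector orthogonal to the right-hand side is constant on the vertices of every simplex, hence
zero. So the face of the sum cut out by a ray has codimension at most one. -/
theorem vectorSpan_argmin_ray (h : IsRaySystem p v) {i : Fin r} {a b : Fin (m i + 1)}
    (hb : b ≠ a) :
    (⊤ : Submodule ℝ (EuclideanSpace ℝ (Fin d))) ≤
      vectorSpan ℝ (argmin (∑ i, convexHull ℝ (Set.range (p i))) (v i a)) ⊔
        (ℝ ∙ (p i a - p i b)) := by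
  rw [top_le_iff, ← Submodule.orthogonal_eq_bot_iff, eq_bot_iff]
  intro w hw
  rw [Submodule.mem_bot]
  have hdiff : ∀ k c c', IsMinAt (p k) (v i a) c → IsMinAt (p k) (v i a) c' →
      (inner ℝ w (p k c) : ℝ) = inner ℝ w (p k c') := by
    intro k c c' hc hc'
    -- Exchanging only the `k`-th summand of a minimiser exhibits $p_{k,c}-p_{k,c'}$ as a direction
    -- of the face.
    choose β hβ using fun k => exists_isMinAt (p k) (v i a)
    have hmem : ∀ c, IsMinAt (p k) (v i a) c →
        ∑ l, p l (Function.update β k c l) ∈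
          argmin (∑ i, convexHull ℝ (Set.range (p i))) (v i a) := by
      intro c hc
      refine (sum_mem_argmin_iff fun l => subset_convexHull _ _ (Set.mem_range_self _)).2 fun l =>
        mem_argmin_convexHull_iff.2 ?_
      by_cases hl : l = k
      · subst hl; simpa using hc
      · simpa [hl] using hβ l
    have hv := vsub_mem_vectorSpan ℝ (hmem c hc) (hmem c' hc')
    rw [vsub_eq_sub, sum_update_sub_sum_update] at hv
    have := (Submodule.mem_orthogonal' _ _).1 hw _ (Submodule.mem_sup_left hv)
    rwa [inner_sub_right, sub_eq_zero] at this
  have hq := (Submodule.mem_orthogonal' _ _).1 hw _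
    (Submodule.mem_sup_right (Submodule.mem_span_singleton_self _))
  rw [inner_sub_right, sub_eq_zero] at hq
  have hall : ∀ c, (inner ℝ w (p i c) : ℝ) = inner ℝ w (p i b) := by
    intro c
    by_cases hc : c = a
    · rw [hc, hq]
    · exact hdiff i c b (h.isMinAt_ray_of_ne' hc) (h.isMinAt_ray_of_ne' hb)
  refine h.eq_zero w fun k c c' => ?_
  by_cases hk : k = i
  · subst hk
    rw [hall, hall c']
  · exact hdiff k c c' (h.isMinAt_ray_of_ne hk a c) (h.isMinAt_ray_of_ne hk a c')

/-- If the sum vanished, a point $y$ of the facet would be orthogonal to $v_{i,a}$. The facet's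
directions fill that hyperplane, so $-y$ is one of them and $y+(-y)=0$ lies in the affine span. -/
theorem sum_supportFn_ray_ne_zero (h : IsRaySystem p v)
    (hP : NonCodegenerate (∑ i, convexHull ℝ (Set.range (p i)))) {i : Fin r} (hi : 0 < m i)
    (a : Fin (m i + 1)) : ∑ k, supportFn (convexHull ℝ (Set.range (p k))) (v i a) ≠ 0 := by
  intro h0
  have : Nontrivial (Fin (m i + 1)) := Fin.nontrivial_iff_two_le.2 (by omega)
  obtain ⟨b, hb⟩ := exists_ne a
  have htop := h.vectorSpan_argmin_ray hb
  have hq := h.inner_self i a a b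
  rw [if_pos rfl, if_neg hb, sub_zero, ← inner_sub_right] at hq
  have hq0 : (inner ℝ (v i a) (p i a - p i b) : ℝ) ≠ 0 := by rw [hq]; exact one_ne_zero
  have hspan : vectorSpan ℝ (∑ i, convexHull ℝ (Set.range (p i))) = ⊤ := by
    rw [← top_le_iff]
    refine htop.trans (sup_le (vectorSpan_mono ℝ fun x hx => hx.1) ?_)
    rw [Submodule.span_singleton_le_iff_mem]
    have hmem : ∀ c, ∑ l, p l (Function.update (fun _ => 0) i c l) ∈
        ∑ i, convexHull ℝ (Set.range (p i)) := fun c =>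
      (Set.mem_fintype_sum _ _).2
        ⟨_, fun l => subset_convexHull _ _ (Set.mem_range_self _), rfl⟩
    have hv := vsub_mem_vectorSpan ℝ (hmem a) (hmem b)
    rwa [vsub_eq_sub, sum_update_sub_sum_update] at hv
  have hfacet : IsFacet (∑ i, convexHull ℝ (Set.range (p i)))
      (argmin (∑ i, convexHull ℝ (Set.range (p i))) (v i a)) := by
    refine ⟨isFace_argmin (argmin_sum_nonempty p _), ?_⟩
    rw [dim, dim, hspan]
    exact finrank_add_one_of_sup_span_singleton (fun x hx => inner_vectorSpan_argmin hx) le_top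
      htop trivial hq0
  obtain ⟨y, hy⟩ := argmin_sum_nonempty p (v i a)
  obtain ⟨g, hg, rfl⟩ := (Set.mem_fintype_sum _ _).1 hy.1
  have hinner : (inner ℝ (v i a) (∑ k, g k) : ℝ) = 0 := by
    rw [inner_sum, ← neg_eq_zero, ← Finset.sum_neg_distrib, ← h0]
    exact Finset.sum_congr rfl fun k _ =>
      (supportFn_eq_of_mem_argmin ((sum_mem_argmin_iff hg).1 hy k)).symm
  refine hP _ hfacet ?_
  have hmem : -∑ k, g k ∈ vectorSpan ℝ
      (argmin (∑ i, convexHull ℝ (Set.range (p i))) (v i a)) :=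
    mem_of_le_sup_span_singleton (fun x hx => inner_vectorSpan_argmin hx) htop hq0 trivial
      (by rw [inner_neg_right, hinner, neg_zero])
  rw [← direction_affineSpan] at hmem
  have := AffineSubspace.vadd_mem_of_mem_direction hmem (subset_affineSpan ℝ _ hy)
  rwa [vadd_eq_add, neg_add_cancel] at this

end IsRaySystem

/-! ### Fine mixed cells -/

theorem IsFineMixedCell.exists_vertices {d r : ℕ} {P : Fin r → Set (EuclideanSpace ℝ (Fin d))}
    (hP : IsFineMixedCell P) : ∃ p : ∀ i, Fin (dim (P i) + 1) → EuclideanSpace ℝ (Fin d),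
      (∀ i, AffineIndependent ℝ (p i)) ∧ ∀ i, P i = convexHull ℝ (Set.range (p i)) := by
  have hex : ∀ i, ∃ p : Fin (dim (P i) + 1) → EuclideanSpace ℝ (Fin d),
      AffineIndependent ℝ p ∧ P i = convexHull ℝ (Set.range p) := by
    intro i
    obtain ⟨n, s, hs⟩ := hP.simplex i
    have hn : dim (P i) = n := by rw [hs, dim_convexHull_range s.independent]
    rw [hn]
    exact ⟨s.points, s.independent, hs⟩
  choose p hp hPp using hex
  exact ⟨p, hp, hPp⟩

theorem IsRaySystem.isNormalizedRays {d r : ℕ} {P : Fin r → Set (EuclideanSpace ℝ (Fin d))}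
    {p v : ∀ i, Fin (dim (P i) + 1) → EuclideanSpace ℝ (Fin d)}
    (hp : ∀ i, P i = convexHull ℝ (Set.range (p i))) (h : IsRaySystem p v) :
    IsNormalizedRays P v := by
  refine ⟨fun i hi a => h.ray_eq_zero hi a, fun i hi => ?_, fun i _ a k hk w hw => ?_,
    fun i hi a => ?_⟩
  · refine ⟨fun a => argmin (P i) (v i a), fun a b hab => ?_, fun a => ⟨?_, ?_⟩⟩
    · by_contra hne
      have hmem : p i a ∈ argmin (P i) (v i b) := by
        rw [hp i]
        exact mem_argmin_convexHull_iff.2 (h.isMinAt_ray_of_ne' hne)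
      dsimp only at hab
      rw [← hab, hp i, mem_argmin_convexHull_iff] at hmem
      exact h.not_isMinAt_ray hi a hmem
    · have := h.isFacet_argmin_ray hi a
      rwa [← hp i] at this
    · exact mem_normalCone_argmin.2 subset_rfl
  · have hsub : P k ⊆ argmin (P k) (v i a) := by
      rw [hp k]
      intro x hx
      obtain ⟨c, h0, h1, rfl⟩ := mem_convexHull_range_iff.1 hx
      exact mem_argmin_of_combination h0 h1 fun b hb => (hb (h.isMinAt_ray_of_ne hk a b)).elim
    rw [real_inner_comm]
    exact inner_vectorSpan_argmin (vectorSpan_mono ℝ hsub hw)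
  · rw [width_eq_supportFn]
    have := h.width_eq_one hi a
    rwa [← hp i] at this

/-- A facet of a simplex in whose normal cone a vector of width one lies has an opposite vertex,
and the vector is the barycentric coordinate of this vertex. -/
theorem exists_vertex_of_mem_normalCone {d n : ℕ} {p : Fin (n + 1) → EuclideanSpace ℝ (Fin d)}
    (hp : AffineIndependent ℝ p) (hn : 0 < n) {F : Set (EuclideanSpace ℝ (Fin d))}
    {v : EuclideanSpace ℝ (Fin d)}
    (hF : IsFacet (convexHull ℝ (Set.range p)) F)
    (hv : v ∈ normalCone (convexHull ℝ (Set.range p)) F)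
    (hwidth : sSup ((fun y => (inner ℝ y v : ℝ)) '' convexHull ℝ (Set.range p)) -
      sInf ((fun y => (inner ℝ y v : ℝ)) '' convexHull ℝ (Set.range p)) = 1) :
    ∃ a, (∀ b c, (inner ℝ v (p b) : ℝ) - inner ℝ v (p c) =
        (if b = a then 1 else 0) - (if c = a then 1 else 0)) ∧
      F = argmin (convexHull ℝ (Set.range p)) v := by
  have : Nontrivial (Fin (n + 1)) := Fin.nontrivial_iff_two_le.2 (by omega)
  obtain ⟨u, rfl⟩ := hF.1.exists_eq_argmin
  obtain ⟨a, ha⟩ := exists_vertex_of_isFacet hp hF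
  obtain ⟨b₀, hb₀⟩ := exists_ne a
  have hmin : ∀ b, b ≠ a → IsMinAt p v b := fun b hb =>
    mem_argmin_convexHull_iff.1 (mem_normalCone_argmin.1 hv
      (mem_argmin_convexHull_iff.2 ((ha b).2 hb)))
  have heq : ∀ b, b ≠ a → (inner ℝ v (p b) : ℝ) = inner ℝ v (p b₀) := fun b hb =>
    le_antisymm (hmin b hb b₀) (hmin b₀ hb₀ b)
  -- So `v` is largest at `a` and smallest at all other vertices; width one makes the difference 1.
  have hmax : IsMinAt p (-v) a := by
    intro c
    rw [inner_neg_left, inner_neg_left, neg_le_neg_iff]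
    by_cases hc : c = a
    · rw [hc]
    · exact hmin c hc a
  rw [width_eq_supportFn, supportFn_eq_of_mem_argmin (mem_argmin_convexHull_iff.2 hmax),
    supportFn_eq_of_mem_argmin (mem_argmin_convexHull_iff.2 (hmin b₀ hb₀)), inner_neg_left]
    at hwidth
  have key : ∀ b, (inner ℝ v (p b) : ℝ) = inner ℝ v (p b₀) + if b = a then 1 else 0 := by
    intro b
    split_ifs with hb
    · rw [hb]; linarith
    · rw [heq b hb, add_zero]
  refine ⟨a, fun b c => by rw [key b, key c]; ring, argmin_eq_of_isMinAt_iff fun b => ?_⟩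
  rw [ha]
  refine ⟨hmin b, ?_⟩
  rintro hb rfl
  have := hb b₀
  rw [key b, if_pos rfl] at this
  linarith

/-- The vertices are relabelled so that vertex `a` lies opposite the facet whose cone contains
$v_{i,a}$. The relabelling is a bijection because the facets are distinct. -/
theorem IsFineMixedCell.exists_isRaySystem {d r : ℕ} {P : Fin r → Set (EuclideanSpace ℝ (Fin d))}
    (hP : IsFineMixedCell P) {v : ∀ i, Fin (dim (P i) + 1) → EuclideanSpace ℝ (Fin d)}
    (hv : IsNormalizedRays P v) : ∃ p : ∀ i, Fin (dim (P i) + 1) → EuclideanSpace ℝ (Fin d),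
      (∀ i, P i = convexHull ℝ (Set.range (p i))) ∧ IsRaySystem p v := by
  obtain ⟨p, hp, hPp⟩ := hP.exists_vertices
  have hex : ∀ i, ∃ q : Fin (dim (P i) + 1) → EuclideanSpace ℝ (Fin d),
      Set.range q = Set.range (p i) ∧ (0 < dim (P i) → ∀ a b c,
        (inner ℝ (v i a) (q b) : ℝ) - inner ℝ (v i a) (q c) =
          (if b = a then 1 else 0) - (if c = a then 1 else 0)) := by
    intro i
    by_cases hi : 0 < dim (P i)
    · obtain ⟨F, hinj, hF⟩ := hv.facets i hi
      have hvert : ∀ a, ∃ a', (∀ b c, (inner ℝ (v i a) (p i b) : ℝ) - inner ℝ (v i a) (p i c) =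
          (if b = a' then 1 else 0) - (if c = a' then 1 else 0)) ∧
            F a = argmin (convexHull ℝ (Set.range (p i))) (v i a) := by
        intro a
        refine exists_vertex_of_mem_normalCone (hp i) hi ?_ ?_ ?_
        · rw [← hPp i]; exact (hF a).1
        · rw [← hPp i]; exact (hF a).2
        · rw [← hPp i]; exact hv.width i hi a
      choose φ hφ hFφ using hvert
      have hφinj : Function.Injective φ := by
        intro a b hab
        apply hinj
        rw [hFφ, hFφ]
        refine argmin_eq_of_isMinAt_iff fun c => forall_congr' fun e => ?_
        rw [← sub_nonpos, hφ a, ← sub_nonpos (b := (inner ℝ (v i b) (p i e) : ℝ)), hφ b, hab]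
      have hφbij := Finite.injective_iff_bijective.1 hφinj
      refine ⟨p i ∘ φ, hφbij.surjective.range_comp _, fun _ a b c => ?_⟩
      rw [Function.comp_apply, Function.comp_apply, hφ a]
      simp only [hφinj.eq_iff]
    · exact ⟨p i, rfl, fun h => (hi h).elim⟩
  choose q hq hqv using hex
  have hPq : ∀ i, P i = convexHull ℝ (Set.range (q i)) := fun i => by rw [hq, ← hPp]
  refine ⟨q, hPq, ⟨fun i a k hk b c => ?_, fun i a b c => ?_, eq_zero_of_inner_eq ?_, hP.sum_dim⟩⟩
  · by_cases hi : 0 < dim (P i)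
    · have hmem : ∀ b, q k b ∈ P k := fun b => by
        rw [hPq k]; exact subset_convexHull _ _ (Set.mem_range_self b)
      have := hv.orthogonal i hi a k hk _ (vsub_mem_vectorSpan ℝ (hmem b) (hmem c))
      rwa [real_inner_comm, vsub_eq_sub, inner_sub_right, sub_eq_zero] at this
    · rw [hv.eq_zero i (by omega) a, inner_zero_left, inner_zero_left]
  · by_cases hi : 0 < dim (P i)
    · exact hqv i hi a b c
    · have : b = c := Fin.ext (by omega)
      rw [this, sub_self, sub_self]
  · have : (fun i => convexHull ℝ (Set.range (q i))) = P := funext fun i => (hPq i).symm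
    rw [this]
    exact hP.dim_sum

theorem IsFineMixedCell.exists_isNormalizedRays {d r : ℕ}
    {P : Fin r → Set (EuclideanSpace ℝ (Fin d))} (hP : IsFineMixedCell P) :
    ∃ v : ∀ i, Fin (dim (P i) + 1) → EuclideanSpace ℝ (Fin d), IsNormalizedRays P v := by
  obtain ⟨p, -, hp⟩ := hP.exists_vertices
  have hP' : (fun i => convexHull ℝ (Set.range (p i))) = P := funext fun i => (hp i).symm
  obtain ⟨v, hv⟩ := DualMixed.exists_isRaySystem (p := p) hP.sum_dim
    (eq_zero_of_inner_eq (by rw [hP']; exact hP.dim_sum))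
  exact ⟨v, hv.isNormalizedRays hp⟩

theorem IsFineMixedCell.isRegular {d r : ℕ} {P : Fin r → Set (EuclideanSpace ℝ (Fin d))}
    (hP : IsFineMixedCell P) (hnc : NonCodegenerate (∑ i, P i)) : IsRegular P := by
  obtain ⟨v, hv⟩ := hP.exists_isNormalizedRays
  obtain ⟨p, hp, h⟩ := hP.exists_isRaySystem hv
  have hP' : ∀ i, convexHull ℝ (Set.range (p i)) = P i := fun i => (hp i).symm
  -- At $x=(1,\dots,1)$ the form is the sum of the support functions, which is non-zero at the rays
  -- by non-codegeneracy.
  refine ⟨hP.dim_sum, fun _ => 1, fun w hw => ?_⟩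
  have hgen := h.generatesRay_iff (x := w)
  simp only [hP'] at hgen
  obtain ⟨i, a, s, hi, hs, rfl⟩ := hgen.1 hw
  have hne := h.sum_supportFn_ray_ne_zero (by simpa only [hP'] using hnc) hi a
  simp only [hP'] at hne
  simp only [supportFn_smul hs.le, one_mul, ← Finset.mul_sum]
  exact mul_ne_zero hs.ne' hne

/-! ### Dual mixed volumes of fine mixed cells -/

/-- Keeping the first $d_i$ rays of each block means omitting the last, so $\kappa$ belongs to the
cone of the last vertices. -/
theorem kappa_eq_absDetFamily {d r : ℕ} {P : Fin r → Set (EuclideanSpace ℝ (Fin d))}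
    (hP : IsFineMixedCell P) (v : ∀ i, Fin (dim (P i) + 1) → EuclideanSpace ℝ (Fin d)) :
    kappa hP v = absDetFamily (finSigmaFinEquiv.trans (finCongr hP.sum_dim))
      (cellRays v fun i => Fin.last (dim (P i))) := by
  simp only [kappa, absDetFamily, cellRays, Fin.succAbove_last]
  rfl

theorem IsFineMixedCell.fanValue_eq {d r : ℕ} {P : Fin r → Set (EuclideanSpace ℝ (Fin d))}
    (hP : IsFineMixedCell P) {v : ∀ i, Fin (dim (P i) + 1) → EuclideanSpace ℝ (Fin d)}
    (hv : IsNormalizedRays P v) {K : Type*} [Field K] [Algebra ℝ K]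
    {u : EuclideanSpace ℝ (Fin d) → K}
    (hu : ∀ s : ℝ, 0 < s → ∀ w, u (s • w) = algebraMap ℝ K s * u w)
    (hne : ∀ i, 0 < dim (P i) → ∀ a, u (v i a) ≠ 0) :
    fanValue (normalFan (∑ i, P i)) u = algebraMap ℝ K (kappa hP v) *
      ((∏ i with 0 < dim (P i), ∑ a, u (v i a)) / ∏ i with 0 < dim (P i), ∏ a, u (v i a)) := by
  obtain ⟨p, hp, h⟩ := hP.exists_isRaySystem hv
  have := h.fanValue_normalFan (finSigmaFinEquiv.trans (finCongr hP.sum_dim))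
    (fun i => Fin.last (dim (P i))) hu hne
  rw [← kappa_eq_absDetFamily hP] at this
  have hP' : (fun i => convexHull ℝ (Set.range (p i))) = P := funext fun i => (hp i).symm
  rwa [hP'] at this

theorem IsFineMixedCell.sum_supportFn {d r : ℕ} {P : Fin r → Set (EuclideanSpace ℝ (Fin d))}
    (hP : IsFineMixedCell P) {v : ∀ i, Fin (dim (P i) + 1) → EuclideanSpace ℝ (Fin d)}
    (hv : IsNormalizedRays P v) {i : Fin r} (hi : 0 < dim (P i)) (k : Fin r) :
    ∑ a, supportFn (P k) (v i a) = if k = i then 1 else 0 := by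
  obtain ⟨p, hp, h⟩ := hP.exists_isRaySystem hv
  have := h.sum_supportFn_ray hi k
  rwa [← hp k] at this

theorem IsFineMixedCell.sum_rays {d r : ℕ} {P : Fin r → Set (EuclideanSpace ℝ (Fin d))}
    (hP : IsFineMixedCell P) {v : ∀ i, Fin (dim (P i) + 1) → EuclideanSpace ℝ (Fin d)}
    (hv : IsNormalizedRays P v) (i : Fin r) : ∑ a, v i a = 0 := by
  obtain ⟨p, hp, h⟩ := hP.exists_isRaySystem hv
  exact h.sum_ray i

theorem IsFineMixedCell.ray_ne_zero {d r : ℕ} {P : Fin r → Set (EuclideanSpace ℝ (Fin d))}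
    (hP : IsFineMixedCell P) {v : ∀ i, Fin (dim (P i) + 1) → EuclideanSpace ℝ (Fin d)}
    (hv : IsNormalizedRays P v) {i : Fin r} (hi : 0 < dim (P i)) (a : Fin (dim (P i) + 1)) :
    v i a ≠ 0 := by
  obtain ⟨p, hp, h⟩ := hP.exists_isRaySystem hv
  exact h.ray_ne_zero hi a

theorem IsFineMixedCell.generatesRay {d r : ℕ} {P : Fin r → Set (EuclideanSpace ℝ (Fin d))}
    (hP : IsFineMixedCell P) {v : ∀ i, Fin (dim (P i) + 1) → EuclideanSpace ℝ (Fin d)}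
    (hv : IsNormalizedRays P v) {i : Fin r} (hi : 0 < dim (P i)) (a : Fin (dim (P i) + 1)) :
    GeneratesRay (normalFan (∑ i, P i)) (v i a) := by
  obtain ⟨p, hp, h⟩ := hP.exists_isRaySystem hv
  have hP' : (fun i => convexHull ℝ (Set.range (p i))) = P := funext fun i => (hp i).symm
  have := h.generatesRay_iff.2 ⟨i, a, 1, hi, one_pos, (one_smul _ _).symm⟩
  rwa [hP'] at this

/-! ### Support forms and the extended sequence -/

theorem supportForm_smul {d : ℕ} {ι : Type*} [Fintype ι]
    (P : ι → Set (EuclideanSpace ℝ (Fin d))) {s : ℝ} (hs : 0 < s)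
    (w : EuclideanSpace ℝ (Fin d)) :
    algebraMap (MvPolynomial ι ℝ) (FractionRing (MvPolynomial ι ℝ)) (supportForm P (s • w)) =
      algebraMap ℝ (FractionRing (MvPolynomial ι ℝ)) s *
        algebraMap (MvPolynomial ι ℝ) (FractionRing (MvPolynomial ι ℝ)) (supportForm P w) := by
  rw [IsScalarTower.algebraMap_apply ℝ (MvPolynomial ι ℝ) (FractionRing (MvPolynomial ι ℝ)),
    ← map_mul, MvPolynomial.algebraMap_eq]
  congr 1
  simp only [supportForm, supportFn_smul hs.le, map_mul, Finset.mul_sum, mul_assoc]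

theorem supportFn_neg_single {d : ℕ} (j : Fin d) (w : EuclideanSpace ℝ (Fin d)) :
    supportFn {-EuclideanSpace.single j (1 : ℝ)} w = w j := by
  simp [supportFn, EuclideanSpace.inner_single_right]

theorem supportForm_extendByBasis {d r : ℕ} (P : Fin r → Set (EuclideanSpace ℝ (Fin d)))
    (w : EuclideanSpace ℝ (Fin d)) : supportForm (extendByBasis P) w =
      (∑ k : Fin r, MvPolynomial.C (supportFn (P k) w) * MvPolynomial.X (Sum.inl k)) +
        ∑ j : Fin d, MvPolynomial.C (w j) * MvPolynomial.X (Sum.inr j) := by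
  simp [supportForm, extendByBasis, supportFn_neg_single]

theorem sum_extendByBasis {d r : ℕ} (P : Fin r → Set (EuclideanSpace ℝ (Fin d))) :
    ∑ i, extendByBasis P i = ∑ i, P i + {∑ j : Fin d, -EuclideanSpace.single j (1 : ℝ)} := by
  rw [Fintype.sum_sum_type, ← Set.coe_singletonAddMonoidHom, map_sum]
  rfl

theorem dim_add_singleton {d : ℕ} (S : Set (EuclideanSpace ℝ (Fin d)))
    (t : EuclideanSpace ℝ (Fin d)) : dim (S + {t}) = dim S := by
  rw [dim, dim, add_comm, Set.singleton_add]
  change Module.finrank ℝ (vectorSpan ℝ (t +ᵥ S)) = _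
  rw [vectorSpan_vadd]

theorem IsFineMixedCell.dualMixedVolume_eq {d r : ℕ}
    {P : Fin r → Set (EuclideanSpace ℝ (Fin d))} (hP : IsFineMixedCell P)
    {v : ∀ i, Fin (dim (P i) + 1) → EuclideanSpace ℝ (Fin d)} (hv : IsNormalizedRays P v)
    (hreg : IsRegular P) : dualMixedVolume P =
      algebraMap ℝ (FractionRing (MvPolynomial (Fin r) ℝ)) (kappa hP v) *
        ((∏ i with 0 < dim (P i), algebraMap (MvPolynomial (Fin r) ℝ)
            (FractionRing (MvPolynomial (Fin r) ℝ)) (MvPolynomial.X i)) /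
          (∏ i with 0 < dim (P i), ∏ a : Fin (dim (P i) + 1),
            algebraMap (MvPolynomial (Fin r) ℝ) (FractionRing (MvPolynomial (Fin r) ℝ))
              (supportForm P (v i a)))) := by
  obtain ⟨hdim, x, hx⟩ := hreg
  rw [dualMixedVolume, if_pos hdim, hP.fanValue_eq hv (fun s hs w => supportForm_smul P hs w)]
  · congr 2
    refine Finset.prod_congr rfl fun i hi => ?_
    rw [← map_sum]
    congr 1
    simp only [supportForm]
    rw [Finset.sum_comm]
    simp only [← Finset.sum_mul, ← map_sum, hP.sum_supportFn hv (Finset.mem_filter.1 hi).2]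
    simp
  -- The denominators are non-zero because they do not vanish at the point `x` given by regularity.
  · intro i hi a h0
    rw [map_eq_zero_iff _ (IsFractionRing.injective _ _)] at h0
    apply hx (v i a) (hP.generatesRay hv hi a)
    have := congrArg (MvPolynomial.eval x) h0
    simpa [supportForm, mul_comm] using this

theorem IsFineMixedCell.dualMixedVolumeZ_eq {d r : ℕ}
    {P : Fin r → Set (EuclideanSpace ℝ (Fin d))} (hP : IsFineMixedCell P)
    {v : ∀ i, Fin (dim (P i) + 1) → EuclideanSpace ℝ (Fin d)} (hv : IsNormalizedRays P v) :
    dualMixedVolumeZ P =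
      algebraMap ℝ (FractionRing (MvPolynomial (Fin r ⊕ Fin d) ℝ)) (kappa hP v) *
        ((∏ i with 0 < dim (P i), algebraMap (MvPolynomial (Fin r ⊕ Fin d) ℝ)
            (FractionRing (MvPolynomial (Fin r ⊕ Fin d) ℝ)) (MvPolynomial.X (Sum.inl i))) /
          (∏ i with 0 < dim (P i), ∏ a : Fin (dim (P i) + 1),
            algebraMap (MvPolynomial (Fin r ⊕ Fin d) ℝ)
              (FractionRing (MvPolynomial (Fin r ⊕ Fin d) ℝ))
              (supportForm (extendByBasis P) (v i a)))) := by
  rw [dualMixedVolumeZ, dualMixedVolume, sum_extendByBasis, dim_add_singleton, if_pos hP.dim_sum,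
    normalFan_add_singleton,
    hP.fanValue_eq hv (fun s hs w => supportForm_smul (extendByBasis P) hs w)]
  · congr 2
    refine Finset.prod_congr rfl fun i hi => ?_
    rw [← map_sum]
    congr 1
    simp only [supportForm_extendByBasis]
    -- The $\mathbf z$-part drops out of the numerator.
    have hz : ∀ j, ∑ a, v i a j = 0 := fun j => by
      simpa using congrArg (fun w : EuclideanSpace ℝ (Fin d) => w j) (hP.sum_rays hv i)
    rw [Finset.sum_add_distrib, Finset.sum_comm,
      Finset.sum_comm (f := fun a j => MvPolynomial.C (v i a j) * MvPolynomial.X (Sum.inr j))]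
    simp only [← Finset.sum_mul, ← map_sum, hz, hP.sum_supportFn hv (Finset.mem_filter.1 hi).2]
    simp
  · intro i hi a h0
    rw [map_eq_zero_iff _ (IsFractionRing.injective _ _), supportForm_extendByBasis] at h0
    -- At $\mathbf x=0$, $\mathbf z=v_{i,a}$ the linear form takes the value $|v_{i,a}|^2$, so no
    -- regularity of `P` is needed.
    have := congrArg (MvPolynomial.eval (Sum.elim 0 fun j => v i a j)) h0
    apply hP.ray_ne_zero hv hi a
    rw [← inner_self_eq_zero (𝕜 := ℝ), PiLp.inner_apply]
    simpa [sq] using this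

end

end DualMixed

theorem mainTheorem7 {d r : ℕ} (P : Fin r → Set (EuclideanSpace ℝ (Fin d)))
    (hP : DualMixed.IsFineMixedCell P) :
    (∃ v : (i : Fin r) → Fin (DualMixed.dim (P i) + 1) → EuclideanSpace ℝ (Fin d),
      DualMixed.IsNormalizedRays P v) ∧
    (DualMixed.NonCodegenerate (∑ i, P i) → DualMixed.IsRegular P) ∧
    ∀ v : (i : Fin r) → Fin (DualMixed.dim (P i) + 1) → EuclideanSpace ℝ (Fin d),
      DualMixed.IsNormalizedRays P v →
      (DualMixed.dualMixedVolumeZ P =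
        algebraMap ℝ (FractionRing (MvPolynomial (Fin r ⊕ Fin d) ℝ)) (DualMixed.kappa hP v) *
          ((∏ i with 0 < DualMixed.dim (P i),
              algebraMap (MvPolynomial (Fin r ⊕ Fin d) ℝ)
                (FractionRing (MvPolynomial (Fin r ⊕ Fin d) ℝ)) (MvPolynomial.X (Sum.inl i))) /
            (∏ i with 0 < DualMixed.dim (P i), ∏ a : Fin (DualMixed.dim (P i) + 1),
              algebraMap (MvPolynomial (Fin r ⊕ Fin d) ℝ)
                (FractionRing (MvPolynomial (Fin r ⊕ Fin d) ℝ))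
                ((∑ k : Fin r, MvPolynomial.C (DualMixed.supportFn (P k) (v i a)) *
                    MvPolynomial.X (Sum.inl k)) +
                  ∑ j : Fin d, MvPolynomial.C (v i a j) * MvPolynomial.X (Sum.inr j))))) ∧
      (DualMixed.IsRegular P →
        DualMixed.dualMixedVolume P =
          algebraMap ℝ (FractionRing (MvPolynomial (Fin r) ℝ)) (DualMixed.kappa hP v) *
            ((∏ i with 0 < DualMixed.dim (P i),
                algebraMap (MvPolynomial (Fin r) ℝ)
                  (FractionRing (MvPolynomial (Fin r) ℝ)) (MvPolynomial.X i)) /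
              (∏ i with 0 < DualMixed.dim (P i), ∏ a : Fin (DualMixed.dim (P i) + 1),
                algebraMap (MvPolynomial (Fin r) ℝ) (FractionRing (MvPolynomial (Fin r) ℝ))
                  (DualMixed.supportForm P (v i a))))) := by
  refine ⟨hP.exists_isNormalizedRays, hP.isRegular, fun v hv => ⟨?_, hP.dualMixedVolume_eq hv⟩⟩
  simp only [← DualMixed.supportForm_extendByBasis]
  exact hP.dualMixedVolumeZ_eq hv
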